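/- **Theorem 1.3.** All groups called *lcsc* are locally compact second countable Hausdorff topological groups, and all Banach spaces are real. *Kazhdan-type properties.* Let $1<p<\infty$. An *$L^p$-space* is a Banach space isometrically isomorphic to $L^p(Y,\mu)$ for a $\sigma$-finite measure $\mu$ on a standard Borel space $Y$. For such a space $E$ let $O(E)$ be the group of linear isometric automorphisms of $E$ with the strong operator topology. Let $G$ be a lcsc group, and let $\pi:G\to O(E)$ and $b:G\to E$ be maps. - $b$ is an *$L^p$-cocycle* if $\pi$ is a continuous homomorphism, $b$ is continuous and $b(gh)=b(g)+\pi(g)b(h)$ for all $g,h\in G$. - $b$ is a *weak $L^p$-quasi-cocycle* if $\pi$ and $b$ are Borel maps ($\pi$ not necessarily a homomorphism) and $\sup_{g,h\in G}\|b(gh)-b(g)-\pi(g)b(h)\|<\infty$. - $b$ is an *$L^p$-quasi-cocycle* if moreover $\pi$ is a homomorphism. For $A\subset G$, the group $G$ has property $(FL^p)$, respectively $(FFL^p)$, $(FFFL^p)$, *relative to $A$* if every $L^p$-cocycle, respectively $L^p$-quasi-cocycle, weak $L^p$-quasi-cocycle on $G$ (with values in any $L^p$-space) is bounded on $A$; and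 $G$ *has* the property if it has it relative to $A=G$. *Uniform approximate lattices.* A subset $\Lambda$ of a lcsc group $G$ is a *uniform approximate lattice* if $\Lambda=\Lambda^{-1}$, $e\in\Lambda$, $\Lambda^2\subset\Lambda F$ for some finite set $F$, and $\Lambda$ is a Delone set: for some proper left-invariant metric $d$ defining the topology of $G$ there are $R>r>0$ such that $d(x,y)\ge r$ for all distinct $x,y\in\Lambda$, and every $x\in G$ has distance at most $R$ from some point of $\Lambda$. Let $\Lambda^\infty$ be the subgroup of $G$ generated by $\Lambda$, regarded as a discrete (countable) group. For a Kazhdan-type property $\mathcal T$, the pair $(\Lambda,\Lambda^\infty)$ *has $\mathcal T$* if the discrete group $\Lambda^\infty$ has $\mathcal T$ relative to $\Lambda$. *Model sets.* A subset of $G$ is a *model set with internal group $H$* if it is of the form $\pi_G(\Gamma\cap(G\times W))$, where $H$ is a lcsc group, $\Gamma<G\times H$ is a lattice (a discrete subgroup of finite covolume) which projects injectively to $G$ and densely to $H$, and $W\subset H$ is compact with non-empty interior. It is *of almost connected type* if $H$ can be chosen such that its quotient by the identity component is compact. A *Meyer set* is a subset $\Delta\subset G$ such that $\Delta\subset M\subset\Delta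 F$ for some model set $M\subset G$ and some finite set $F\subset G$. **Statement.** Let $p\in(1,\infty)$ and let $\mathcal T$ be one of the properties $(FL^p)$, $(FFL^p)$, $(FFFL^p)$. Let $G$ be a lcsc group and let $\Lambda\subset G$ be a uniform approximate lattice such that one of the following holds: 1. $\Lambda$ is a model set; 2. $\Lambda$ is a Meyer set which is contained in a model set of almost connected type. Then $G$ has $\mathcal T$ if and only if $(\Lambda,\Lambda^\infty)$ has $\mathcal T$. -/

import Mathlib

open MeasureTheory
open scoped ENNReal Pointwise

universe u v

/-! ### Uniform approximate lattices -/

/-- A metric on a topological group is left-admissible if it is left-invariant, proper and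
induces the given topology. -/
structure IsLeftAdmissible {G : Type u} [Group G] [t : TopologicalSpace G]
    (m : MetricSpace G) : Prop where
  topology_eq : m.toPseudoMetricSpace.toUniformSpace.toTopologicalSpace = t
  proper : @ProperSpace G m.toPseudoMetricSpace
  left_invariant : ∀ g x y : G, m.dist (g * x) (g * y) = m.dist x y

/-- Delone subsets: uniformly discrete and relatively dense for some left-admissible metric. -/
def IsDelone {G : Type u} [Group G] [TopologicalSpace G] (Λ : Set G) : Prop :=
  ∃ m : MetricSpace G, IsLeftAdmissible m ∧ ∃ r R : ℝ, 0 < r ∧ r < R ∧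
    (∀ x ∈ Λ, ∀ y ∈ Λ, x ≠ y → r ≤ m.dist x y) ∧
    (∀ x : G, ∃ y ∈ Λ, m.dist x y ≤ R)

/-- An approximate subgroup (symmetric, containing the identity, with `Λ ^ 2` covered by finitely
many translates of `Λ`) which is a Delone set.  Mathlib's `IsApproximateSubgroup K Λ` asks for
`Λ ^ 2 ⊆ F * Λ` with `F` of cardinality at most `K`; as `Λ` is symmetric this amounts to
`Λ ^ 2 ⊆ Λ * F⁻¹`, and the elements of `F` that are not in `Λ ^ 3` can be dropped. -/
structure IsUniformApproximateLattice {G : Type u} [Group G] [TopologicalSpace G]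
    (Λ : Set G) : Prop where
  approximate_subgroup : ∃ K : ℝ, IsApproximateSubgroup K Λ
  delone : IsDelone Λ

/-! ### Model sets and Meyer sets -/

/-- A lattice: a discrete subgroup `Γ` such that the homogeneous space `X ⧸ Γ` carries an
invariant Borel probability measure. -/
def IsLattice {X : Type u} [Group X] [TopologicalSpace X] (Γ : Subgroup X) : Prop :=
  DiscreteTopology Γ ∧
    letI : MeasurableSpace (X ⧸ Γ) := borel (X ⧸ Γ)
    ∃ μ : Measure (X ⧸ Γ), IsProbabilityMeasure μ ∧
      ∀ g : X, μ.map (fun x : X ⧸ Γ => g • x) = μ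

/-- `(G, H, Γ)` is a cut-and-project scheme: `Γ` is a lattice in `G × H` which projects
injectively to `G` and densely to `H`. -/
structure IsCutAndProjectScheme {G : Type u} {H : Type v} [Group G] [TopologicalSpace G]
    [Group H] [TopologicalSpace H] (Γ : Subgroup (G × H)) : Prop where
  lattice : IsLattice Γ
  injective : Set.InjOn Prod.fst (Γ : Set (G × H))
  dense : Dense (Prod.snd '' (Γ : Set (G × H)))

/-- The set `Λ(G, H, Γ, W) = π_G (Γ ∩ (G × W))`. -/
def cutAndProject {G : Type u} {H : Type v} [Group G] [Group H]
    (Γ : Subgroup (G × H)) (W : Set H) : Set G :=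
  Prod.fst '' ((Γ : Set (G × H)) ∩ {x | x.2 ∈ W})

/-- `Λ` is a model set with internal group `H`: it is `Λ(G, H, Γ, W)` for a cut-and-project
scheme `(G, H, Γ)` and a compact window `W` with non-empty interior. -/
def IsModelSetWithInternalGroup {G : Type u} [Group G] [TopologicalSpace G]
    (H : Type v) [Group H] [TopologicalSpace H] (Λ : Set G) : Prop :=
  ∃ (Γ : Subgroup (G × H)) (W : Set H), IsCutAndProjectScheme Γ ∧
    IsCompact W ∧ (interior W).Nonempty ∧ Λ = cutAndProject Γ W

/-- Model sets: the internal group is some locally compact second countable group. -/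
def IsModelSet {G : Type u} [Group G] [TopologicalSpace G] (Λ : Set G) : Prop :=
  ∃ (H : Type v) (_ : Group H) (_ : TopologicalSpace H) (_ : IsTopologicalGroup H)
    (_ : LocallyCompactSpace H) (_ : SecondCountableTopology H) (_ : T2Space H),
    IsModelSetWithInternalGroup H Λ

/-- A topological group is almost connected if its quotient by the identity component is
compact. -/
def IsAlmostConnected (H : Type v) [Group H] [TopologicalSpace H] [IsTopologicalGroup H] : Prop :=
  CompactSpace (H ⧸ Subgroup.connectedComponentOfOne H)

/-- Model sets of almost connected type: the internal group can be chosen almost connected. -/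
def IsModelSetOfAlmostConnectedType {G : Type u} [Group G] [TopologicalSpace G]
    (Λ : Set G) : Prop :=
  ∃ (H : Type v) (_ : Group H) (_ : TopologicalSpace H) (_ : IsTopologicalGroup H)
    (_ : LocallyCompactSpace H) (_ : SecondCountableTopology H) (_ : T2Space H),
    IsAlmostConnected H ∧ IsModelSetWithInternalGroup H Λ

/-- Meyer sets: left-syndetic subsets of model sets. -/
def IsMeyerSet {G : Type u} [Group G] [TopologicalSpace G] (Δ : Set G) : Prop :=
  ∃ M : Set G, IsModelSet.{u, v} M ∧ ∃ F : Set G, F.Finite ∧ Δ ⊆ M ∧ M ⊆ Δ * F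

/-! ### Kazhdan-type properties -/

/-- A real Banach space is an `L^p`-space if it is isometrically isomorphic to `L^p(Y, μ)` for a
σ-finite measure `μ` on a standard Borel space `Y`. -/
def IsLpSpace (p : ℝ≥0∞) [Fact (1 ≤ p)] (E : Type) [NormedAddCommGroup E] [NormedSpace ℝ E] :
    Prop :=
  ∃ (Y : Type) (_ : MeasurableSpace Y) (_ : StandardBorelSpace Y) (μ : Measure Y)
    (_ : SigmaFinite μ), Nonempty (E ≃ₗᵢ[ℝ] Lp ℝ p μ)

/-- The strong operator topology (topology of pointwise convergence) on the orthogonal group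
`O(E)`, the group of linear isometric automorphisms of `E`. -/
@[reducible] def strongOperatorTopology (E : Type) [NormedAddCommGroup E] [NormedSpace ℝ E] :
    TopologicalSpace (E ≃ₗᵢ[ℝ] E) :=
  TopologicalSpace.induced (fun (T : E ≃ₗᵢ[ℝ] E) (x : E) => T x) inferInstance

section Cocycles

variable {G : Type u} [Group G] [TopologicalSpace G]
  {E : Type} [NormedAddCommGroup E] [NormedSpace ℝ E]

/-- `(π, b)` is a continuous affine isometric action: `π` is a continuous orthogonal
representation and `b` is a continuous cocycle for `π`. -/
structure IsCocycle (π : G → (E ≃ₗᵢ[ℝ] E)) (b : G → E) : Prop where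
  map_mul : ∀ g h : G, π (g * h) = π g * π h
  continuous_linear_part : @Continuous G (E ≃ₗᵢ[ℝ] E) _ (strongOperatorTopology E) π
  continuous_cocycle : Continuous b
  cocycle : ∀ g h : G, b (g * h) = b g + π g (b h)

/-- `π : G → O(E)` is an arbitrary Borel map, and `b` is a Borel weak quasi-cocycle for `π`. -/
structure IsWeakQuasiCocycle (π : G → (E ≃ₗᵢ[ℝ] E)) (b : G → E) : Prop where
  borel_linear_part : @Measurable G (E ≃ₗᵢ[ℝ] E) (borel G)
    (@borel (E ≃ₗᵢ[ℝ] E) (strongOperatorTopology E)) π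
  borel_cocycle : @Measurable G E (borel G) (borel E) b
  defect : ∃ D : ℝ, ∀ g h : G, ‖b (g * h) - b g - π g (b h)‖ ≤ D

/-- A quasi-cocycle is a weak quasi-cocycle for which `π` is a homomorphism. -/
structure IsQuasiCocycle (π : G → (E ≃ₗᵢ[ℝ] E)) (b : G → E) : Prop
    extends IsWeakQuasiCocycle π b where
  map_mul : ∀ g h : G, π (g * h) = π g * π h

end Cocycles

/-- The three kinds of Kazhdan-type properties: `(FL^p)`, `(FFL^p)` and `(FFFL^p)`. -/
inductive KazhdanType : Type
  | F
  | FF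
  | FFF

/-- The class of pairs `(π, b)` that each Kazhdan-type property speaks about. -/
def KazhdanType.IsPair (T : KazhdanType) {G : Type u} [Group G] [TopologicalSpace G]
    {E : Type} [NormedAddCommGroup E] [NormedSpace ℝ E]
    (π : G → (E ≃ₗᵢ[ℝ] E)) (b : G → E) : Prop :=
  match T with
  | .F => IsCocycle π b
  | .FF => IsQuasiCocycle π b
  | .FFF => IsWeakQuasiCocycle π b

/-- `G` has the Kazhdan-type property `T` (with exponent `p`) relative to the subset `A`: every
cocycle (quasi-cocycle, weak quasi-cocycle) of `G` in an `L^p`-space is bounded on `A`. -/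
def HasRelativeKazhdanProperty (T : KazhdanType) (p : ℝ≥0∞) [Fact (1 ≤ p)]
    (G : Type u) [Group G] [TopologicalSpace G] (A : Set G) : Prop :=
  ∀ (E : Type) [NormedAddCommGroup E] [NormedSpace ℝ E], IsLpSpace p E →
    ∀ (π : G → (E ≃ₗᵢ[ℝ] E)) (b : G → E), T.IsPair π b → ∃ C : ℝ, ∀ a ∈ A, ‖b a‖ ≤ C

/-- `G` has the Kazhdan-type property `T`. -/
def HasKazhdanProperty (T : KazhdanType) (p : ℝ≥0∞) [Fact (1 ≤ p)]
    (G : Type u) [Group G] [TopologicalSpace G] : Prop :=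
  HasRelativeKazhdanProperty T p G Set.univ

/-- The approximate group `(Λ, Λ^∞)` has `T`: the enveloping group `Λ^∞` generated by `Λ`, as a
discrete group (not with the subspace topology), has `T` relative to `Λ`. -/
def ApproximateGroupHasKazhdanProperty (T : KazhdanType) (p : ℝ≥0∞) [Fact (1 ≤ p)]
    {G : Type u} [Group G] (Λ : Set G) : Prop :=
  @HasRelativeKazhdanProperty T p _ (Subgroup.closure Λ) _ ⊥
    {x : Subgroup.closure Λ | (x : G) ∈ Λ}

/-! From `Λ` to `G`: a pair on `G` restricts to the discrete group `Λ^∞`, hence is bounded on `Λ`.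
Its norm is Borel and subadditive up to a constant, so by a Steinhaus argument it is bounded on
compact sets. Since `G = Λ K` with `K` compact, it is bounded on `G`
(`hasKazhdanProperty_of_isDelone`).

From `G` to `Λ`: in both cases `Λ` lies in a model set with lattice `Γ` and compact window `W`. Let
`τ : Λ^∞ → H` be the star map and `H'` the closure of its image. The graph of `τ` is discrete in `G
× H'`, being part of `Γ`, and cocompact, because `Λ` is relatively dense and `τ` maps it into `W`.
So it is enough to treat a discrete cocompact subgroup `Γ` of a product `G × H`, and to bound a pair
`(π, b)` on the elements of `Γ` lying over a compact subset of `H`.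

The orbit space `X` of `Γ` in `G × H` carries a finite `G`-invariant measure `μ`, and a Borel
fundamental domain gives a cocycle `α : G × X → Γ` for the action of `G`. The pair induced to
`L^p(X, E)`, again an `L^p`-space, is of the same kind, hence bounded. By Markov's inequality `‖b (α
g x)‖` is at most `t` outside a set of measure `δ`, with `t` independent of `g`
(`HasKazhdanProperty.exists_measure_le`).

It remains to pass from most points to a single `γ₀`. Near the base point of `X`, the arrows `(h,
x)` with `α h x` equal to `γ₀` up to bounded factors form a set `A`. Its fibres may be arbitrarily
small, of proportion `ε`, so the bound at a single `h` says nothing. Instead, run a random walk on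
`X` with about `1 / ε` steps. With probability comparable to the measure of the set `X₀` of starting
points of `A`, some step lies in `A`. By the cocycle identity, the value of `α` at that step is
determined by its values on the path before the step, the path after it and the whole path. If `b
γ₀` were too large, one of the three would exceed `t`. All three are single group elements, hence
controlled by `δ`, and near-independence gives `μ X₀ ≤ 8 δ` (`RandomWalk.measure_le_of_bad_arrows`).
As `X₀` does not depend on `γ₀`, taking `δ = μ X₀ / 16` is a contradiction. -/

/-! ### Random walks and bad arrows -/

namespace RandomWalk

variable {G : Type*} [Group G]

/-- The product `w (i + n - 1) * ⋯ * w i` of `n` consecutive increments. -/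
def segment (w : ℕ → G) (i : ℕ) : ℕ → G
  | 0 => 1
  | n + 1 => w (i + n) * segment w i n

lemma segment_congr {w w' : ℕ → G} {i n : ℕ} (h : ∀ k, i ≤ k → k < i + n → w k = w' k) :
    segment w i n = segment w' i n := by
  induction n with
  | zero => rfl
  | succ n ih =>
    simp only [segment]
    rw [ih fun k h1 h2 => h k h1 (by omega), h (i + n) (by omega) (by omega)]

lemma segment_add (w : ℕ → G) (i n k : ℕ) :
    segment w i (n + k) = segment w (i + n) k * segment w i n := by
  induction k with
  | zero => simp [segment]
  | succ k ih => rw [← add_assoc]; simp only [segment]; rw [ih, mul_assoc, add_assoc]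

/-- Extension of a finite sequence of increments by `1`. -/
def extend {N : ℕ} (w : Fin N → G) (n : ℕ) : G := if h : n < N then w ⟨n, h⟩ else 1

lemma extend_coe {N : ℕ} (w : Fin N → G) (i : Fin N) : extend w i = w i := by
  simp [extend]

lemma extend_update {N : ℕ} (w : Fin N → G) (i : Fin N) (a : G) {k : ℕ} (hk : k ≠ i) :
    extend (Function.update w i a) k = extend w k := by
  unfold extend
  split_ifs with h
  · rw [Function.update_of_ne]
    intro h'
    exact hk (by rw [← h'])
  · rfl

lemma segment_extend_update {N : ℕ} (w : Fin N → G) (i : Fin N) (a : G) {j n : ℕ}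
    (h : (i : ℕ) < j ∨ j + n ≤ i) :
    segment (extend (Function.update w i a)) j n = segment (extend w) j n :=
  segment_congr fun k _ _ => extend_update w i a (by omega)

variable [MeasurableSpace G]

lemma measurable_extend {N : ℕ} (n : ℕ) : Measurable fun w : Fin N → G => extend w n := by
  unfold extend
  split_ifs with h
  · exact measurable_pi_apply _
  · exact measurable_const

lemma measurable_segment [MeasurableMul₂ G] {N : ℕ} (i n : ℕ) :
    Measurable fun w : Fin N → G => segment (extend w) i n := by
  induction n with
  | zero => exact measurable_const
  | succ n ih => exact (measurable_extend _).mul ih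

variable {X : Type*} [MeasurableSpace X]

omit [Group G] in
/-- An event about the `i`-th increment which has conditional probability at most `ε` is
`ε`-independent of every event not involving this increment. -/
lemma measure_coord_inter_le {N : ℕ} (m : Measure G) [IsProbabilityMeasure m] (μ : Measure X)
    [SFinite μ] (i : Fin N) {A : Set (G × X)} (hA : MeasurableSet A) {ε : ℝ≥0∞}
    (hε : ∀ x, m {g | (g, x) ∈ A} ≤ ε) {S : Set ((Fin N → G) × X)} (hS : MeasurableSet S)
    (hSi : ∀ w x a, (Function.update w i a, x) ∈ S ↔ (w, x) ∈ S) :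
    ((Measure.pi fun _ : Fin N => m).prod μ) {z | (z.1 i, z.2) ∈ A ∧ z ∈ S} ≤
      ε * ((Measure.pi fun _ : Fin N => m).prod μ) S := by
  classical
  have hmeas : MeasurableSet {z : (Fin N → G) × X | (z.1 i, z.2) ∈ A ∧ z ∈ S} :=
    (((measurable_pi_apply i).comp measurable_fst).prodMk measurable_snd hA).inter hS
  rw [Measure.prod_apply_symm hmeas, Measure.prod_apply_symm hS,
    ← lintegral_const_mul _ (measurable_measure_prodMk_right hS)]
  refine lintegral_mono fun x => ?_
  have h1 : MeasurableSet {w : Fin N → G | (w i, x) ∈ A ∧ (w, x) ∈ S} :=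
    measurable_prodMk_right hmeas
  have h2 : MeasurableSet {w : Fin N → G | (w, x) ∈ S} := measurable_prodMk_right hS
  change (Measure.pi fun _ : Fin N => m) {w | (w i, x) ∈ A ∧ (w, x) ∈ S} ≤
    ε * (Measure.pi fun _ : Fin N => m) {w | (w, x) ∈ S}
  rw [← lintegral_indicator_one h1, ← lintegral_indicator_one h2,
    ← lintegral_const_mul _ (measurable_one.indicator h2)]
  -- It suffices to integrate out the `i`-th increment alone: membership in `S` does not depend on
  -- it.
  refine lintegral_le_of_lmarginal_le {i} (measurable_one.indicator h1)
    ((measurable_one.indicator h2).const_mul _) ?_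
  intro w
  rw [lmarginal_singleton, lmarginal_singleton]
  simp only [Set.indicator_apply, Set.mem_ofPred_eq, hSi, Function.update_self, Pi.one_apply]
  by_cases hw : (w, x) ∈ S
  · simp only [hw, and_true, if_true, mul_one, lintegral_const, measure_univ]
    refine le_trans (le_of_eq ?_) (hε x)
    have h3 : MeasurableSet {g | (g, x) ∈ A} := measurable_prodMk_right hA
    rw [← lintegral_indicator_one h3]
    rfl
  · simp [hw]

variable [MeasurableMul₂ G] [MulAction G X] [MeasurableSMul₂ G X]

/-- Passing to the position at time `n` preserves the measure on paths. -/
lemma measurePreserving_position {N : ℕ} (m : Measure G) [IsProbabilityMeasure m]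
    (μ : Measure X) [SFinite μ] [SMulInvariantMeasure G X μ] (n : ℕ) :
    MeasurePreserving (fun z : (Fin N → G) × X => (z.1, segment (extend z.1) 0 n • z.2))
      ((Measure.pi fun _ : Fin N => m).prod μ) ((Measure.pi fun _ : Fin N => m).prod μ) := by
  refine (MeasurePreserving.id _).skew_product
    (g := fun w x => segment (extend w) 0 n • x) ?_ ?_
  · exact ((measurable_segment 0 n).comp measurable_fst).smul measurable_snd
  · exact Filter.Eventually.of_forall fun w => (measurePreserving_smul _ μ).map_eq

omit [Group G] [MeasurableMul₂ G] [MulAction G X] [MeasurableSMul₂ G X] in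
lemma measure_prod_le_of_forall {W : Type*} [MeasurableSpace W] (P : Measure W)
    [IsProbabilityMeasure P] (μ : Measure X) [SFinite μ] {S : Set (W × X)} (hS : MeasurableSet S)
    {δ : ℝ≥0∞} (h : ∀ w, μ {x | (w, x) ∈ S} ≤ δ) : (P.prod μ) S ≤ δ := by
  rw [Measure.prod_apply hS]
  calc ∫⁻ w, μ (Prod.mk w ⁻¹' S) ∂P ≤ ∫⁻ _, δ ∂P := lintegral_mono h
    _ = δ := by simp

variable [MeasurableInv G]

/-- Let `G` act on a finite measure space `X`, let `A ⊆ G × X` be a set of arrows all of whose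
fibres over `X₀ ⊆ X` have the same measure `ε` for a probability measure `m` on `G`, and let `B`
be a set of bad arrows such that every element of `G` is bad only on a set of measure at most `δ`.
If, whenever an arrow of `A` is written in terms of three composable arrows, one of these is bad,
then `X₀` has measure at most `8 * δ`. -/
theorem measure_le_of_bad_arrows (m : Measure G) [IsProbabilityMeasure m] (μ : Measure X)
    [IsFiniteMeasure μ] [SMulInvariantMeasure G X μ] {A B : Set (G × X)} (hA : MeasurableSet A)
    (hB : MeasurableSet B) {X₀ : Set X} (hX₀ : MeasurableSet X₀) {ε δ : ℝ≥0∞} (hε : ε ≠ 0)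
    (hAX₀ : ∀ x ∈ X₀, m {g | (g, x) ∈ A} = ε) (hAX₀' : ∀ g x, (g, x) ∈ A → x ∈ X₀)
    (hA' : ∀ y, m {g | (g, g⁻¹ • y) ∈ A} ≤ ε) (hBδ : ∀ g, μ {x | (g, x) ∈ B} ≤ δ)
    (hAB : ∀ (l₁ h l₂ : G) (x : X), (h, l₁ • x) ∈ A →
      (l₁, x) ∈ B ∨ (l₂, (h * l₁) • x) ∈ B ∨ (l₂ * h * l₁, x) ∈ B) :
    μ X₀ ≤ 8 * δ := by
  classical
  rcases X₀.eq_empty_or_nonempty with rfl | ⟨x₀, hx₀⟩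
  · simp
  have hε1 : ε ≤ 1 := hAX₀ x₀ hx₀ ▸ prob_le_one
  have hεtop : ε ≠ ∞ := ne_top_of_le_ne_top ENNReal.one_ne_top hε1
  by_cases hδtop : δ = ∞
  · simp [hδtop]
  have hAle : ∀ x, m {g | (g, x) ∈ A} ≤ ε := by
    intro x
    by_cases hx : x ∈ X₀
    · exact (hAX₀ x hx).le
    · have : {g | (g, x) ∈ A} = ∅ := by
        ext g
        simp only [Set.mem_ofPred_eq, Set.mem_empty_iff_false, iff_false]
        exact fun h => hx (hAX₀' g x h)
      simp [this]
  set e := ε.toReal with he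
  have he0 : 0 < e := ENNReal.toReal_pos hε hεtop
  have he1 : e ≤ 1 := ENNReal.toReal_mono ENNReal.one_ne_top hε1
  -- The walk has `N` steps with `1 / 2 ≤ N e ≤ 1`: long enough to meet `A` with probability
  -- comparable to `μ X₀`, short enough that double visits do not cancel this.
  set N := ⌊1 / e⌋₊ with hN
  set P := (Measure.pi fun _ : Fin N => m).prod μ with hP
  let l : ((Fin N → G) × X) → ℕ → G := fun z n => segment (extend z.1) 0 n
  have hl : ∀ n, Measurable fun z => l z n := fun n => (measurable_segment 0 n).comp measurable_fst
  let pos : ℕ → ((Fin N → G) × X) → ((Fin N → G) × X) := fun n z => (z.1, l z n • z.2)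
  have hpos : ∀ n, MeasurePreserving (pos n) P P := measurePreserving_position m μ
  let ev : Fin N → Set ((Fin N → G) × X) := fun i => {z | (z.1 i, l z i • z.2) ∈ A}
  have hev : ∀ i, MeasurableSet (ev i) := fun i =>
    (((measurable_pi_apply i).comp measurable_fst).prodMk ((hl i).smul measurable_snd)) hA
  have hPev : ∀ i, P (ev i) = ε * μ X₀ := by
    intro i
    have hm : MeasurableSet {z : (Fin N → G) × X | (z.1 i, z.2) ∈ A} :=
      ((measurable_pi_apply i).comp measurable_fst).prodMk measurable_snd hA
    have h1 : ev i = pos i ⁻¹' {z | (z.1 i, z.2) ∈ A} := rfl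
    rw [h1, (hpos i).measure_preimage hm.nullMeasurableSet, hP, Measure.prod_apply_symm hm]
    have h2 : ∀ x, (Measure.pi fun _ : Fin N => m)
        ((fun w => (w, x)) ⁻¹' {z : (Fin N → G) × X | (z.1 i, z.2) ∈ A}) =
        X₀.indicator (fun _ => ε) x := by
      intro x
      have h3 : MeasurableSet {g | (g, x) ∈ A} := measurable_prodMk_right hA
      have h4 := (measurePreserving_eval (fun _ : Fin N => m) i).measure_preimage
        h3.nullMeasurableSet
      refine h4.trans ?_
      by_cases hx : x ∈ X₀
      · simp [hx, hAX₀ x hx]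
      · have : {g | (g, x) ∈ A} = ∅ := by
          ext g
          simp only [Set.mem_ofPred_eq, Set.mem_empty_iff_false, iff_false]
          exact fun h => hx (hAX₀' g x h)
        simp [hx, this]
    simp_rw [h2]
    rw [lintegral_indicator hX₀, setLIntegral_const]
  have hpair : ∀ i j : Fin N, i < j → P (ev j ∩ ev i) ≤ ε * (ε * μ X₀) := by
    intro i j hij
    have hij' : (i : ℕ) < j := hij
    -- Seen from the position at time `j`, the event at the earlier time `i` involves only
    -- increments before `j`, so it is unaffected by the `j`-th one.
    let S : Set ((Fin N → G) × X) := {z | (z.1 i, l z i • (l z j)⁻¹ • z.2) ∈ A}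
    have hS : MeasurableSet S := (((measurable_pi_apply i).comp measurable_fst).prodMk
      ((hl i).smul ((hl j).inv.smul measurable_snd))) hA
    have h1 : ev j ∩ ev i = pos j ⁻¹' {z | (z.1 j, z.2) ∈ A ∧ z ∈ S} := by
      ext z
      simp only [ev, pos, S, l, Set.mem_inter_iff, Set.mem_ofPred_eq, Set.mem_preimage,
        inv_smul_smul]
    have h2 : ev i = pos j ⁻¹' S := by
      ext z
      simp only [ev, pos, S, l, Set.mem_ofPred_eq, Set.mem_preimage, inv_smul_smul]
    have hm : MeasurableSet {z : (Fin N → G) × X | (z.1 j, z.2) ∈ A ∧ z ∈ S} :=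
      (((measurable_pi_apply j).comp measurable_fst).prodMk measurable_snd hA).inter hS
    rw [h1, (hpos j).measure_preimage hm.nullMeasurableSet, ← hPev i, h2,
      (hpos j).measure_preimage hS.nullMeasurableSet]
    refine measure_coord_inter_le m μ j hA hAle hS fun w x a => ?_
    simp only [S, l, Set.mem_ofPred_eq]
    rw [segment_extend_update w j a (by omega), segment_extend_update w j a (by omega),
      Function.update_of_ne hij.ne]
  let bad₁ : Fin N → Set ((Fin N → G) × X) := fun i => {z | (l z i, z.2) ∈ B}
  let r : ((Fin N → G) × X) → Fin N → G := fun z i => segment (extend z.1) (i + 1) (N - (i + 1))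
  have hr : ∀ i, Measurable fun z => r z i := fun i =>
    (measurable_segment _ _).comp measurable_fst
  let bad₂ : Fin N → Set ((Fin N → G) × X) := fun i => {z | (r z i, l z (i + 1) • z.2) ∈ B}
  let bad₃ : Set ((Fin N → G) × X) := {z | (l z N, z.2) ∈ B}
  have hbad₃ : MeasurableSet bad₃ := (hl N).prodMk measurable_snd hB
  have hPbad₃ : P bad₃ ≤ δ := measure_prod_le_of_forall _ μ hbad₃ fun w =>
    hBδ (segment (extend w) 0 N)
  have hlsucc : ∀ (z) (i : Fin N), l z (i + 1) = z.1 i * l z i := by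
    intro z i
    simp only [l, segment, zero_add, extend_coe]
  have hPbad₁ : ∀ i, P (ev i ∩ bad₁ i) ≤ ε * δ := by
    intro i
    let S : Set ((Fin N → G) × X) := {z | (l z i, (l z i)⁻¹ • z.2) ∈ B}
    have hS : MeasurableSet S := (hl i).prodMk ((hl i).inv.smul measurable_snd) hB
    have h1 : ev i ∩ bad₁ i = pos i ⁻¹' {z | (z.1 i, z.2) ∈ A ∧ z ∈ S} := by
      ext z
      simp only [ev, bad₁, pos, S, l, Set.mem_inter_iff, Set.mem_ofPred_eq, Set.mem_preimage,
        inv_smul_smul]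
    have hm : MeasurableSet {z : (Fin N → G) × X | (z.1 i, z.2) ∈ A ∧ z ∈ S} :=
      (((measurable_pi_apply i).comp measurable_fst).prodMk measurable_snd hA).inter hS
    rw [h1, (hpos i).measure_preimage hm.nullMeasurableSet]
    refine (measure_coord_inter_le m μ i hA hAle hS fun w x a => ?_).trans ?_
    · simp only [S, l, Set.mem_ofPred_eq]
      rw [segment_extend_update w i a (by omega)]
    · gcongr
      refine measure_prod_le_of_forall _ μ hS fun w => ?_
      set g := segment (extend w) 0 i with hg
      have h2 : {x | (w, x) ∈ S} = (fun x => g⁻¹ • x) ⁻¹' {x | (g, x) ∈ B} := rfl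
      have h3 : MeasurableSet {x | (g, x) ∈ B} := measurable_prodMk_left hB
      rw [h2, (measurePreserving_smul g⁻¹ μ).measure_preimage h3.nullMeasurableSet]
      exact hBδ g
  have hPbad₂ : ∀ i, P (ev i ∩ bad₂ i) ≤ ε * δ := by
    intro i
    let S : Set ((Fin N → G) × X) := {z | (r z i, z.2) ∈ B}
    have hS : MeasurableSet S := (hr i).prodMk measurable_snd hB
    -- The path after the step starts at its target, so everything is read from the position at time
    -- `i + 1`. There the step is described by its target, which is why fibres of `A` over targets
    -- must be controlled too.
    let A' : Set (G × X) := {z | (z.1, z.1⁻¹ • z.2) ∈ A}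
    have hA'm : MeasurableSet A' :=
      (measurable_fst.prodMk (measurable_fst.inv.smul measurable_snd)) hA
    have h1 : ev i ∩ bad₂ i = pos (i + 1) ⁻¹' {z | (z.1 i, z.2) ∈ A' ∧ z ∈ S} := by
      ext z
      simp only [ev, bad₂, pos, S, A', Set.mem_inter_iff, Set.mem_ofPred_eq, Set.mem_preimage,
        hlsucc, mul_smul, inv_smul_smul, r]
    have hm : MeasurableSet {z : (Fin N → G) × X | (z.1 i, z.2) ∈ A' ∧ z ∈ S} :=
      MeasurableSet.inter (s₁ := (fun z : (Fin N → G) × X => (z.1 i, z.2)) ⁻¹' A')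
        (((measurable_pi_apply i).comp measurable_fst).prodMk measurable_snd hA'm) hS
    rw [h1, (hpos _).measure_preimage hm.nullMeasurableSet]
    refine (measure_coord_inter_le m μ i hA'm hA' hS fun w x a => ?_).trans ?_
    · simp only [S, r, Set.mem_ofPred_eq]
      rw [segment_extend_update w i a (by omega)]
    · gcongr
      exact measure_prod_le_of_forall _ μ hS fun w => hBδ (segment (extend w) (i + 1) (N - (i + 1)))
  have hcover : ∀ i, ev i ⊆ (ev i ∩ bad₁ i) ∪ (ev i ∩ bad₂ i) ∪ (ev i ∩ bad₃) := by
    intro i z hz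
    have hlN : l z N = r z i * z.1 i * l z i := by
      rw [mul_assoc, ← hlsucc]
      have := segment_add (extend z.1) 0 (i + 1) (N - (i + 1))
      rw [zero_add] at this
      change segment (extend z.1) 0 N = _
      rw [← this]
      congr 1
      omega
    rcases hAB (l z i) (z.1 i) (r z i) z.2 hz with h | h | h
    · exact Or.inl (Or.inl ⟨hz, h⟩)
    · rw [← hlsucc] at h
      exact Or.inl (Or.inr ⟨hz, h⟩)
    · rw [← hlN] at h
      exact Or.inr ⟨hz, h⟩
  -- The whole path involves every increment, so `bad₃` is not independent of any step. Splitting by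
  -- the first visit to `A` makes the events disjoint, so that `bad₃` is counted only once in the
  -- sum over all steps.
  let first : Fin N → Set ((Fin N → G) × X) := fun j => ev j \ ⋃ i ∈ Finset.Iio j, ev i
  have hfirst : ∀ j, MeasurableSet (first j) := fun j =>
    (hev j).diff (Finset.measurableSet_biUnion _ fun i _ => hev i)
  have hdisj : Pairwise (Function.onFun Disjoint first) := by
    have key : ∀ i j : Fin N, i < j → Disjoint (first i) (first j) := by
      intro i j hij
      rw [Set.disjoint_left]
      intro z hz hz'
      exact hz'.2 (Set.mem_biUnion (Finset.mem_coe.2 (Finset.mem_Iio.2 hij)) hz.1)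
    intro i j hij
    rcases lt_or_gt_of_ne hij with h | h
    · exact key i j h
    · exact (key j i h).symm
  have hsum : ∑ j, P (first j ∩ bad₃) ≤ δ := by
    rw [← measure_biUnion_finset (fun i _ j _ hij =>
      (hdisj hij).mono Set.inter_subset_left Set.inter_subset_left)
      fun j _ => (hfirst j).inter hbad₃]
    refine (measure_mono ?_).trans hPbad₃
    exact Set.iUnion₂_subset fun j _ => Set.inter_subset_right
  have hmain : ∀ j : Fin N,
      ε * μ X₀ ≤ P (first j ∩ bad₃) + (2 * (ε * δ) + j * (ε * (ε * μ X₀))) := by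
    intro j
    have hsub : ev j ⊆ (first j ∩ bad₃) ∪ ((ev j ∩ bad₁ j) ∪ (ev j ∩ bad₂ j) ∪
        ⋃ i ∈ Finset.Iio j, (ev j ∩ ev i)) := by
      intro z hz
      by_cases h : z ∈ ⋃ i ∈ Finset.Iio j, ev i
      · refine Or.inr (Or.inr ?_)
        obtain ⟨i, hi, hzi⟩ := Set.mem_iUnion₂.1 h
        exact Set.mem_iUnion₂.2 ⟨i, hi, hz, hzi⟩
      · rcases hcover j hz with h' | h'
        · exact Or.inr (Or.inl h')
        · exact Or.inl ⟨⟨hz, h⟩, h'.2⟩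
    refine (hPev j).symm.le.trans ((measure_mono hsub).trans ((measure_union_le _ _).trans ?_))
    gcongr
    refine (measure_union_le _ _).trans (add_le_add ((measure_union_le _ _).trans ?_) ?_)
    · rw [two_mul]
      exact add_le_add (hPbad₁ j) (hPbad₂ j)
    · refine (measure_biUnion_finset_le _ _).trans ?_
      refine (Finset.sum_le_sum fun i hi => hpair i j (Finset.mem_Iio.1 hi)).trans ?_
      simp
  set M := (μ X₀).toReal with hM
  set d := δ.toReal with hd
  have hμtop : μ X₀ ≠ ∞ := measure_ne_top _ _
  have hreal : ∀ j : Fin N, e * M ≤ (P (first j ∩ bad₃)).toReal + (2 * (e * d) + j * (e * (e * M))) := by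
    intro j
    have hfin : P (first j ∩ bad₃) ≠ ∞ := measure_ne_top _ _
    have h1 : (2 * (ε * δ) : ℝ≥0∞) ≠ ∞ := by finiteness
    have h2 : ((j : ℕ) * (ε * (ε * μ X₀)) : ℝ≥0∞) ≠ ∞ := by finiteness
    have := ENNReal.toReal_mono (by finiteness) (hmain j)
    rw [ENNReal.toReal_add hfin (by finiteness), ENNReal.toReal_add h1 h2] at this
    simpa [ENNReal.toReal_mul] using this
  have hsumreal : ∑ j, (P (first j ∩ bad₃)).toReal ≤ d := by
    rw [← ENNReal.toReal_sum fun j _ => measure_ne_top _ _]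
    exact ENNReal.toReal_mono hδtop hsum
  have htotal := Finset.sum_le_sum fun (j : Fin N) (_ : j ∈ Finset.univ) => hreal j
  simp only [Finset.sum_add_distrib, Finset.sum_const, Finset.card_univ, Fintype.card_fin,
    nsmul_eq_mul] at htotal
  rw [← Finset.sum_mul, Fin.sum_univ_eq_sum_range (fun n => (n : ℝ)) N] at htotal
  have hgauss : ∑ n ∈ Finset.range N, (n : ℝ) ≤ N * N / 2 := by
    have : ∀ n : ℕ, ∑ k ∈ Finset.range n, (k : ℝ) ≤ n * n / 2 := by
      intro n
      induction n with
      | zero => simp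
      | succ n ih => rw [Finset.sum_range_succ]; push_cast; nlinarith
    exact this N
  have hNe : (N : ℝ) * e ≤ 1 := by
    have := Nat.floor_le (div_nonneg zero_le_one he0.le)
    rwa [le_div_iff₀ he0] at this
  have hNe' : 1 / 2 ≤ (N : ℝ) * e := by
    have h1 : 1 / e < N + 1 := Nat.lt_floor_add_one _
    rw [div_lt_iff₀ he0] at h1
    have h2 : (1 : ℝ) ≤ N := by
      have : 1 ≤ N := Nat.le_floor (by rw [Nat.cast_one, le_div_iff₀ he0]; linarith)
      exact_mod_cast this
    nlinarith
  have hM0 : 0 ≤ M := ENNReal.toReal_nonneg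
  have hd0 : 0 ≤ d := ENNReal.toReal_nonneg
  have hfinal : M ≤ 8 * d := by
    have h1 : (∑ n ∈ Finset.range N, (n : ℝ)) * (e * (e * M)) ≤
        N * N / 2 * (e * (e * M)) := by gcongr
    set t := (N : ℝ) * e with ht
    have h2 : t * M ≤ d + (2 * t * d + t * t * M / 2) := by
      have e1 : (N : ℝ) * (e * M) = t * M := by rw [ht]; ring
      have e2 : (N : ℝ) * (2 * (e * d)) = 2 * t * d := by rw [ht]; ring
      have e3 : (N : ℝ) * N / 2 * (e * (e * M)) = t * t * M / 2 := by rw [ht]; ring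
      rw [← e1, ← e2, ← e3]
      linarith
    -- On `[1/2, 1]` the function `t - t² / 2` is at least `3 / 8`, while `1 + 2 t ≤ 3`; hence `3 /
    -- 8 * M ≤ 3 d`, the source of the constant 8.
    have h3 : 3 / 8 * M ≤ (t - t * t / 2) * M := by
      gcongr
      nlinarith
    nlinarith
  rw [← ENNReal.toReal_le_toReal hμtop (by finiteness)]
  simpa [ENNReal.toReal_mul] using hfinal

end RandomWalk

/-! ### Measurability of maps into `L^p` -/

section MeasurableLp

/-- In a second countable space every open set is a countable union of balls. For maps into `L^p`
this reduces measurability to that of norms, which are parametrised integrals. -/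
lemma measurable_of_measurable_edist {S α : Type*} [MeasurableSpace S] [PseudoEMetricSpace α]
    [SecondCountableTopology α] [MeasurableSpace α] [BorelSpace α] {f : S → α}
    (h : ∀ v, Measurable fun s => edist (f s) v) : Measurable f := by
  refine measurable_of_isOpen fun U hU => ?_
  choose! r hr hrU using fun x hx => EMetric.isOpen_iff.1 hU x hx
  obtain ⟨T, hT, hTU⟩ := TopologicalSpace.isOpen_iUnion_countable
    (fun x : U => Metric.eball (x : α) (r x)) fun x => Metric.isOpen_eball
  have hU' : U = ⋃ x ∈ T, Metric.eball (x : α) (r x) := by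
    rw [hTU]
    refine Set.Subset.antisymm (fun x hx => ?_) (Set.iUnion_subset fun x => hrU x x.2)
    exact Set.mem_iUnion.2 ⟨⟨x, hx⟩, Metric.mem_eball_self (hr x hx)⟩
  rw [hU', Set.preimage_iUnion₂]
  exact MeasurableSet.biUnion hT fun x _ => measurableSet_lt (h x) measurable_const

variable {S Y E : Type*} [MeasurableSpace S] [MeasurableSpace Y] {ν : Measure Y} [SFinite ν]
  [NormedAddCommGroup E] {p : ℝ≥0∞}

lemma measurable_eLpNorm_of_uncurry (hp : p ≠ 0) (hp' : p ≠ ∞) {k : S → Y → E}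
    (hk : StronglyMeasurable (Function.uncurry k)) : Measurable fun s => eLpNorm (k s) p ν := by
  simp_rw [eLpNorm_eq_lintegral_rpow_enorm_toReal hp hp']
  exact ((hk.enorm.pow_const _).lintegral_prod_right').pow_const _

/-- A map into `L^p` which is represented by a jointly measurable function is measurable. -/
lemma measurable_Lp_of_uncurry [Fact (1 ≤ p)] (hp : p ≠ ∞)
    [SecondCountableTopology (Lp E p ν)] [MeasurableSpace (Lp E p ν)] [BorelSpace (Lp E p ν)]
    {K : S → Lp E p ν} {k : S → Y → E} (hk : StronglyMeasurable (Function.uncurry k))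
    (hK : ∀ s, K s =ᵐ[ν] k s) : Measurable K := by
  have hp0 : p ≠ 0 := (zero_lt_one.trans_le Fact.out).ne'
  refine measurable_of_measurable_edist fun v => ?_
  have h1 : ∀ s, edist (K s) v = eLpNorm (fun y => k s y - (Lp.aestronglyMeasurable v).mk v y) p ν := by
    intro s
    rw [Lp.edist_def]
    refine eLpNorm_congr_ae ?_
    filter_upwards [hK s, (Lp.aestronglyMeasurable v).ae_eq_mk] with y h2 h3
    simp only [Pi.sub_apply]
    rw [h2, h3]
  simp_rw [h1]
  refine measurable_eLpNorm_of_uncurry hp0 hp ?_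
  exact hk.sub ((Lp.aestronglyMeasurable v).stronglyMeasurable_mk.comp_measurable measurable_snd)

end MeasurableLp

section IsometryOfAEEq

variable {X X' E F : Type*} [MeasurableSpace X] [MeasurableSpace X'] {μ : Measure X}
  {μ' : Measure X'} [NormedAddCommGroup E] [NormedSpace ℝ E] [NormedAddCommGroup F]
  [NormedSpace ℝ F] {p : ℝ≥0∞} [Fact (1 ≤ p)]

/-- A linear isometry between `L^p`-spaces, from an explicit formula for functions which is linear
and norm-preserving up to null sets. -/
noncomputable def MeasureTheory.Lp.isometryOfAEEq (Φ : Lp E p μ → X' → F)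
    (hm : ∀ f, MemLp (Φ f) p μ') (hadd : ∀ f g, Φ (f + g) =ᵐ[μ'] Φ f + Φ g)
    (hsmul : ∀ (c : ℝ) f, Φ (c • f) =ᵐ[μ'] c • Φ f)
    (hnorm : ∀ f, eLpNorm (Φ f) p μ' = eLpNorm f p μ) : Lp E p μ →ₗᵢ[ℝ] Lp F p μ' where
  toFun f := (hm f).toLp
  map_add' f g := ((MemLp.toLp_eq_toLp_iff _ ((hm f).add (hm g))).2 (hadd f g)).trans
    (MemLp.toLp_add _ _)
  map_smul' c f := ((MemLp.toLp_eq_toLp_iff _ ((hm f).const_smul c)).2 (hsmul c f)).trans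
    (MemLp.toLp_const_smul _ _)
  norm_map' f := by
    refine (Lp.norm_toLp _ (hm f)).trans ?_
    rw [hnorm, Lp.norm_def]

lemma MeasureTheory.Lp.coeFn_isometryOfAEEq (Φ : Lp E p μ → X' → F)
    (hm : ∀ f, MemLp (Φ f) p μ') (hadd : ∀ f g, Φ (f + g) =ᵐ[μ'] Φ f + Φ g)
    (hsmul : ∀ (c : ℝ) f, Φ (c • f) =ᵐ[μ'] c • Φ f)
    (hnorm : ∀ f, eLpNorm (Φ f) p μ' = eLpNorm f p μ) (f : Lp E p μ) :
    Lp.isometryOfAEEq Φ hm hadd hsmul hnorm f =ᵐ[μ'] Φ f :=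
  (hm f).coeFn_toLp

end IsometryOfAEEq

/-! ### Fubini: iterated `L^p`-spaces are `L^p`-spaces -/

section Curry

variable {X Y : Type*} [MeasurableSpace X] [MeasurableSpace Y] {μ : Measure X} {ν : Measure Y}
  [SFinite ν] {p : ℝ≥0∞} [hp1 : Fact (1 ≤ p)]

open Classical in
/-- The `x`-section of a function on `X × Y`, as an element of `L^p(Y)` (zero if the section is
not in `L^p`). -/
noncomputable def sectionLp (p : ℝ≥0∞) (ν : Measure Y) (f : X × Y → ℝ) (x : X) : Lp ℝ p ν :=
  if h : MemLp (fun y => f (x, y)) p ν then h.toLp _ else 0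

lemma eLpNorm_prod_eq (hp : p ≠ ∞) {f : X × Y → ℝ} (hf : StronglyMeasurable f) :
    eLpNorm (fun x => (eLpNorm (fun y => f (x, y)) p ν)) p μ = eLpNorm f p (μ.prod ν) := by
  have hp0 : p ≠ 0 := (zero_lt_one.trans_le hp1.out).ne'
  have hpr : p.toReal ≠ 0 := (ENNReal.toReal_pos hp0 hp).ne'
  rw [eLpNorm_eq_lintegral_rpow_enorm_toReal hp0 hp, eLpNorm_eq_lintegral_rpow_enorm_toReal hp0 hp,
    lintegral_prod _ (hf.enorm.pow_const _).aemeasurable]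
  congr 1
  refine lintegral_congr fun x => ?_
  rw [eLpNorm_eq_lintegral_rpow_enorm_toReal hp0 hp, enorm_eq_self, ← ENNReal.rpow_mul,
    one_div_mul_cancel hpr, ENNReal.rpow_one]

lemma ae_memLp_section (hp : p ≠ ∞) {f : X × Y → ℝ} (hf : StronglyMeasurable f)
    (hf' : MemLp f p (μ.prod ν)) : ∀ᵐ x ∂μ, MemLp (fun y => f (x, y)) p ν := by
  have hp0 : p ≠ 0 := (zero_lt_one.trans_le hp1.out).ne'
  have h1 : ∫⁻ x, (eLpNorm (fun y => f (x, y)) p ν) ^ p.toReal ∂μ < ∞ := by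
    have h2 := hf'.2
    rw [← eLpNorm_prod_eq hp hf, eLpNorm_lt_top_iff_lintegral_rpow_enorm_lt_top hp0 hp] at h2
    simpa using h2
  have hm : Measurable fun x => eLpNorm (fun y => f (x, y)) p ν :=
    measurable_eLpNorm_of_uncurry hp0 hp (k := fun x y => f (x, y)) hf
  filter_upwards [ae_lt_top (hm.pow_const _) h1.ne] with x hx
  refine ⟨(hf.comp_measurable measurable_prodMk_left).aestronglyMeasurable, ?_⟩
  rwa [ENNReal.rpow_lt_top_iff_of_pos (ENNReal.toReal_pos hp0 hp)] at hx

/-- The set of `x` whose section lies in `L^p` is measurable, so cutting `f` off outside it gives a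
jointly measurable representative that agrees with the default value zero. -/
lemma stronglyMeasurable_sectionLp (hp : p ≠ ∞) [SecondCountableTopology (Lp ℝ p ν)]
    {f : X × Y → ℝ} (hf : StronglyMeasurable f) : StronglyMeasurable (sectionLp p ν f) := by
  classical
  let _ : MeasurableSpace (Lp ℝ p ν) := borel _
  have _ : BorelSpace (Lp ℝ p ν) := ⟨rfl⟩
  have hp0 : p ≠ 0 := (zero_lt_one.trans_le hp1.out).ne'
  have hmem : ∀ x, MemLp (fun y => f (x, y)) p ν ↔ x ∈ {x | eLpNorm (fun y => f (x, y)) p ν < ∞} :=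
    fun x => ⟨fun h => h.2,
      fun h => ⟨(hf.comp_measurable measurable_prodMk_left).aestronglyMeasurable, h⟩⟩
  have hset : MeasurableSet {x | eLpNorm (fun y => f (x, y)) p ν < ∞} :=
    measurableSet_lt (measurable_eLpNorm_of_uncurry hp0 hp (k := fun x y => f (x, y)) hf)
      measurable_const
  refine (measurable_Lp_of_uncurry hp (k := fun x y =>
    ({x | eLpNorm (fun y => f (x, y)) p ν < ∞} ×ˢ (Set.univ : Set Y)).indicator f (x, y)) ?_
    fun x => ?_).stronglyMeasurable
  · exact hf.indicator (hset.prod MeasurableSet.univ)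
  · unfold sectionLp
    by_cases hx : MemLp (fun y => f (x, y)) p ν
    · rw [dif_pos hx]
      filter_upwards [hx.coeFn_toLp] with y hy
      rw [hy, Set.indicator_of_mem]
      exact ⟨(hmem x).1 hx, trivial⟩
    · rw [dif_neg hx]
      filter_upwards [Lp.coeFn_zero ℝ p ν] with y hy
      rw [hy, Set.indicator_of_notMem]
      · rfl
      · exact fun h => hx ((hmem x).2 h.1)

lemma eLpNorm_sectionLp (hp : p ≠ ∞) {f : X × Y → ℝ} (hf : StronglyMeasurable f)
    (hf' : MemLp f p (μ.prod ν)) :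
    eLpNorm (sectionLp p ν f) p μ = eLpNorm f p (μ.prod ν) := by
  rw [← eLpNorm_prod_eq hp hf]
  refine eLpNorm_congr_enorm_ae ?_
  filter_upwards [ae_memLp_section hp hf hf'] with x hx
  rw [sectionLp, dif_pos hx, Lp.enorm_toLp, enorm_eq_self]

omit hp1 in
lemma sectionLp_ae_eq {f g : X × Y → ℝ} (h : f =ᵐ[μ.prod ν] g) : sectionLp p ν f =ᵐ[μ] sectionLp p ν g := by
  filter_upwards [Measure.ae_ae_of_ae_prod h] with x hx
  unfold sectionLp
  have : MemLp (fun y => f (x, y)) p ν ↔ MemLp (fun y => g (x, y)) p ν := memLp_congr_ae hx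
  by_cases h1 : MemLp (fun y => f (x, y)) p ν
  · rw [dif_pos h1, dif_pos (this.1 h1)]
    exact (MemLp.toLp_eq_toLp_iff _ _).2 hx
  · rw [dif_neg h1, dif_neg (this.not.1 h1)]

/-- The isometry `L^p(X × Y) → L^p(X, L^p(Y))`. -/
noncomputable def curryLp (hp : p ≠ ∞) [SecondCountableTopology (Lp ℝ p ν)] :
    Lp ℝ p (μ.prod ν) →ₗᵢ[ℝ] Lp (Lp ℝ p ν) p μ :=
  Lp.isometryOfAEEq (fun f => sectionLp p ν f)
    (fun f => ⟨(stronglyMeasurable_sectionLp hp (Lp.stronglyMeasurable f)).aestronglyMeasurable,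
      (eLpNorm_sectionLp hp (Lp.stronglyMeasurable f) (Lp.memLp f)).trans_lt (Lp.memLp f).2⟩)
    (fun f g => by
      filter_upwards [sectionLp_ae_eq (p := p) (Lp.coeFn_add f g),
        ae_memLp_section hp (Lp.stronglyMeasurable f) (Lp.memLp f),
        ae_memLp_section hp (Lp.stronglyMeasurable g) (Lp.memLp g)] with x hx hf hg
      rw [hx, Pi.add_apply]
      unfold sectionLp
      have h : MemLp (fun y => (⇑f + ⇑g) (x, y)) p ν := hf.add hg
      rw [dif_pos hf, dif_pos hg, dif_pos h]
      rfl)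
    (fun c f => by
      filter_upwards [sectionLp_ae_eq (p := p) (Lp.coeFn_smul c f),
        ae_memLp_section hp (Lp.stronglyMeasurable f) (Lp.memLp f)] with x hx hf
      rw [hx, Pi.smul_apply]
      unfold sectionLp
      have h : MemLp (fun y => (c • ⇑f) (x, y)) p ν := hf.const_smul c
      rw [dif_pos hf, dif_pos h]
      rfl)
    (fun f => eLpNorm_sectionLp hp (Lp.stronglyMeasurable f) (Lp.memLp f))

lemma coeFn_curryLp (hp : p ≠ ∞) [SecondCountableTopology (Lp ℝ p ν)] (f : Lp ℝ p (μ.prod ν)) :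
    curryLp hp f =ᵐ[μ] sectionLp p ν f :=
  Lp.coeFn_isometryOfAEEq _ _ _ _ _ f

omit [MeasurableSpace X] [SFinite ν] hp1 in
lemma sectionLp_indicator {s : Set X} (c : Lp ℝ p ν) (x : X) :
    sectionLp p ν (fun z : X × Y => s.indicator (fun _ => (1 : ℝ)) z.1 * c z.2) x =
      s.indicator (fun _ => c) x := by
  unfold sectionLp
  by_cases hx : x ∈ s
  · have h : MemLp (fun y => s.indicator (fun _ => (1 : ℝ)) x * c y) p ν := by
      simpa [hx] using Lp.memLp c
    rw [dif_pos h, Set.indicator_of_mem hx]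
    refine Lp.ext (h.coeFn_toLp.trans ?_)
    simp [hx]
  · have h : MemLp (fun y => s.indicator (fun _ => (1 : ℝ)) x * c y) p ν := by
      simp [hx]
    rw [dif_pos h, Set.indicator_of_notMem hx]
    refine Lp.ext (h.coeFn_toLp.trans ?_)
    filter_upwards [Lp.coeFn_zero ℝ p ν] with y hy
    simp only [Set.indicator_of_notMem hx, zero_mul]
    rw [hy, Pi.zero_apply]

lemma memLp_indicator_mul (hp : p ≠ ∞) {s : Set X} (hs : MeasurableSet s) (hμs : μ s ≠ ∞)
    (c : Lp ℝ p ν) : MemLp (fun z : X × Y => s.indicator (fun _ => (1 : ℝ)) z.1 * c z.2) p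
      (μ.prod ν) := by
  have hsm : StronglyMeasurable (fun z : X × Y => s.indicator (fun _ => (1 : ℝ)) z.1 * c z.2) :=
    ((stronglyMeasurable_const.indicator hs).comp_measurable measurable_fst).mul
      ((Lp.stronglyMeasurable c).comp_measurable measurable_snd)
  refine ⟨hsm.aestronglyMeasurable, ?_⟩
  rw [← eLpNorm_prod_eq hp hsm]
  have h1 : ∀ x, eLpNorm (fun y => s.indicator (fun _ => (1 : ℝ)) x * c y) p ν =
      ‖s.indicator (fun _ => c) x‖ₑ := by
    intro x
    by_cases hx : x ∈ s
    · simp [hx, Lp.enorm_def]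
    · simp [hx]
  simp only [h1]
  rw [eLpNorm_enorm]
  exact (memLp_indicator_const p hs c (Or.inr hμs)).2

/-- The range of an isometry of complete spaces is closed. It contains the indicators `1_s ⊗ c`,
which span a dense subspace. -/
lemma curryLp_surjective (hp : p ≠ ∞) [SecondCountableTopology (Lp ℝ p ν)] :
    Function.Surjective (curryLp (μ := μ) (ν := ν) hp) := by
  intro F
  refine Lp.induction hp (motive := fun F => ∃ f, curryLp (μ := μ) (ν := ν) hp f = F)
    ?_ ?_ ?_ F
  · intro c s hs hμs
    have hmem := memLp_indicator_mul (μ := μ) hp hs hμs.ne c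
    refine ⟨hmem.toLp _, Lp.ext ((coeFn_curryLp hp _).trans ?_)⟩
    rw [Lp.simpleFunc.coe_indicatorConst]
    refine (sectionLp_ae_eq (p := p) hmem.coeFn_toLp).trans
      (Filter.EventuallyEq.trans ?_ indicatorConstLp_coeFn.symm)
    exact Filter.Eventually.of_forall fun x => sectionLp_indicator c x
  · rintro f g hf hg - ⟨f', hf'⟩ ⟨g', hg'⟩
    exact ⟨f' + g', by rw [map_add, hf', hg']⟩
  · exact (curryLp (μ := μ) (ν := ν) hp).isometry.isClosedEmbedding.isClosed_range

end Curry

section IsLpSpace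

variable {E F : Type} [NormedAddCommGroup E] [NormedSpace ℝ E] [NormedAddCommGroup F]
  [NormedSpace ℝ F] {p : ℝ≥0∞} [Fact (1 ≤ p)]

lemma secondCountableTopology_Lp (hp : p ≠ ∞) {Y : Type*} [MeasurableSpace Y]
    [StandardBorelSpace Y] (μ : Measure Y) [SigmaFinite μ] (F : Type*) [NormedAddCommGroup F]
    [SecondCountableTopology F] : SecondCountableTopology (Lp F p μ) := by
  have _ : Fact (p ≠ ∞) := ⟨hp⟩
  infer_instance

lemma IsLpSpace.secondCountableTopology (hp : p ≠ ∞) (hE : IsLpSpace p E) :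
    SecondCountableTopology E := by
  obtain ⟨Y, _, _, μ, _, ⟨e⟩⟩ := hE
  have := secondCountableTopology_Lp hp μ ℝ
  exact e.toHomeomorph.secondCountableTopology

/-- Post-composition with an isometric isomorphism. -/
noncomputable def compLpIsometry {X : Type*} [MeasurableSpace X] (p : ℝ≥0∞) [Fact (1 ≤ p)]
    (μ : Measure X) (e : E ≃ₗᵢ[ℝ] F) : Lp E p μ →ₗᵢ[ℝ] Lp F p μ where
  toLinearMap := (e.toContinuousLinearEquiv.toContinuousLinearMap.compLpL p μ).toLinearMap
  norm_map' f := by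
    rw [Lp.norm_def, Lp.norm_def]
    congr 1
    refine eLpNorm_congr_norm_ae ?_
    filter_upwards [ContinuousLinearMap.coeFn_compLpL
      e.toContinuousLinearEquiv.toContinuousLinearMap f] with x hx
    exact (congrArg norm hx).trans (e.norm_map _)

lemma coeFn_compLpIsometry {X : Type*} [MeasurableSpace X] (μ : Measure X) (e : E ≃ₗᵢ[ℝ] F)
    (f : Lp E p μ) : compLpIsometry p μ e f =ᵐ[μ] fun x => e (f x) :=
  ContinuousLinearMap.coeFn_compLpL e.toContinuousLinearEquiv.toContinuousLinearMap f

lemma compLpIsometry_surjective {X : Type*} [MeasurableSpace X] (μ : Measure X)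
    (e : E ≃ₗᵢ[ℝ] F) : Function.Surjective (compLpIsometry p μ e) := by
  intro f
  refine ⟨compLpIsometry p μ e.symm f, Lp.ext ?_⟩
  filter_upwards [coeFn_compLpIsometry μ e (compLpIsometry p μ e.symm f),
    coeFn_compLpIsometry μ e.symm f] with x h1 h2
  rw [h1, h2, e.apply_symm_apply]

/-- `L^p(X, E)` is an `L^p`-space if `E` is one. -/
theorem IsLpSpace.bochner (hp : p ≠ ∞) (hE : IsLpSpace p E) {X : Type} [MeasurableSpace X]
    [StandardBorelSpace X] (μ : Measure X) [SigmaFinite μ] : IsLpSpace p (Lp E p μ) := by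
  obtain ⟨Y, _, _, ν, _, ⟨e⟩⟩ := hE
  have := secondCountableTopology_Lp hp ν ℝ
  refine ⟨X × Y, inferInstance, inferInstance, μ.prod ν, inferInstance,
    ⟨(LinearIsometryEquiv.ofSurjective _ (compLpIsometry_surjective μ e)).trans
      (LinearIsometryEquiv.ofSurjective _ (curryLp_surjective hp)).symm⟩⟩

end IsLpSpace

/-! ### Twisted translations of `L^p(X, E)` -/

section Twisted

variable {X E Γ : Type*} [MeasurableSpace X] {μ : Measure X} [NormedAddCommGroup E]
  [NormedSpace ℝ E] [SecondCountableTopology E] [Countable Γ] [MeasurableSpace Γ]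
  [DiscreteMeasurableSpace Γ] {p : ℝ≥0∞} [Fact (1 ≤ p)]

-- As `Γ` is countable, `(γ, e) ↦ T γ e` is measurable as soon as each slice is; no measurable
-- structure on the operators is needed.
omit [NormedSpace ℝ E] in
lemma StronglyMeasurable.apply_countable_family {Y : Type*} [MeasurableSpace Y] {T : Γ → E → E}
    (hT : ∀ γ, Continuous (T γ)) {θ : Y → Γ} (hθ : Measurable θ) {f : Y → E}
    (hf : StronglyMeasurable f) : StronglyMeasurable fun y => T (θ y) (f y) := by
  let _ : MeasurableSpace E := borel E
  have _ : BorelSpace E := ⟨rfl⟩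
  have h : Measurable fun q : Γ × E => T q.1 q.2 :=
    measurable_from_prod_countable_right fun γ => (hT γ).measurable
  exact (h.comp (hθ.prodMk hf.measurable)).stronglyMeasurable

omit [NormedSpace ℝ E] in
lemma AEStronglyMeasurable.apply_countable_family {T : Γ → E → E}
    (hT : ∀ γ, Continuous (T γ)) {θ : X → Γ} (hθ : Measurable θ) {f : X → E}
    (hf : AEStronglyMeasurable f μ) : AEStronglyMeasurable (fun y => T (θ y) (f y)) μ := by
  refine ⟨fun y => T (θ y) (hf.mk f y),
    StronglyMeasurable.apply_countable_family hT hθ hf.stronglyMeasurable_mk, ?_⟩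
  filter_upwards [hf.ae_eq_mk] with y hy
  rw [← hy]

omit [SecondCountableTopology E] [Countable Γ] [MeasurableSpace Γ]
  [DiscreteMeasurableSpace Γ] [Fact (1 ≤ p)] in
lemma eLpNorm_twist (π : Γ → E ≃ₗᵢ[ℝ] E) (θ : X → Γ) {S : X → X}
    (hS : MeasurePreserving S μ μ) (f : Lp E p μ) :
    eLpNorm (fun x => π (θ x) (f (S x))) p μ = eLpNorm f p μ := by
  have h : eLpNorm (fun x => π (θ x) (f (S x))) p μ = eLpNorm (f ∘ S) p μ :=
    eLpNorm_congr_norm_ae (Filter.Eventually.of_forall fun x => (π (θ x)).norm_map _)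
  rw [h, eLpNorm_comp_measurePreserving (Lp.aestronglyMeasurable f) hS]

/-- The isometry `f ↦ (x ↦ π (θ x) (f (S x)))` of `L^p(X, E)`. -/
noncomputable def twistedIsometry (p : ℝ≥0∞) [Fact (1 ≤ p)] (π : Γ → E ≃ₗᵢ[ℝ] E) {θ : X → Γ}
    (hθ : Measurable θ) {S : X → X} (hS : MeasurePreserving S μ μ) : Lp E p μ →ₗᵢ[ℝ] Lp E p μ :=
  Lp.isometryOfAEEq (fun f x => π (θ x) (f (S x)))
    (fun f => ⟨AEStronglyMeasurable.apply_countable_family (fun γ => (π γ).continuous) hθ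
      ((Lp.aestronglyMeasurable f).comp_measurePreserving hS),
      (eLpNorm_twist π θ hS f).trans_lt (Lp.memLp f).2⟩)
    (fun f g => by
      filter_upwards [hS.quasiMeasurePreserving.ae (Lp.coeFn_add f g)] with x hx
      change π (θ x) ((f + g : Lp E p μ) (S x)) = π (θ x) (f (S x)) + π (θ x) (g (S x))
      rw [hx, Pi.add_apply, map_add])
    (fun c f => by
      filter_upwards [hS.quasiMeasurePreserving.ae (Lp.coeFn_smul c f)] with x hx
      change π (θ x) ((c • f : Lp E p μ) (S x)) = c • π (θ x) (f (S x))
      rw [hx, Pi.smul_apply, map_smul])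
    (fun f => eLpNorm_twist π θ hS f)

lemma coeFn_twistedIsometry (π : Γ → E ≃ₗᵢ[ℝ] E) {θ : X → Γ} (hθ : Measurable θ) {S : X → X}
    (hS : MeasurePreserving S μ μ) (f : Lp E p μ) :
    twistedIsometry p π hθ hS f =ᵐ[μ] fun x => π (θ x) (f (S x)) :=
  Lp.coeFn_isometryOfAEEq _ _ _ _ _ f

/-- A preimage of `f` is given by the same kind of formula, `x ↦ π (θ (S' x))⁻¹ (f (S' x))`. -/
lemma twistedIsometry_surjective (π : Γ → E ≃ₗᵢ[ℝ] E) {θ : X → Γ} (hθ : Measurable θ)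
    {S S' : X → X} (hS : MeasurePreserving S μ μ) (hS' : MeasurePreserving S' μ μ)
    (h : ∀ x, S' (S x) = x) : Function.Surjective (twistedIsometry p π hθ hS) := by
  intro f
  refine ⟨twistedIsometry p (fun γ => (π γ).symm) (hθ.comp hS'.measurable) hS' f, Lp.ext ?_⟩
  filter_upwards [coeFn_twistedIsometry π hθ hS
    (twistedIsometry p (fun γ => (π γ).symm) (hθ.comp hS'.measurable) hS' f),
    hS.quasiMeasurePreserving.ae
      (coeFn_twistedIsometry (p := p) (fun γ => (π γ).symm) (hθ.comp hS'.measurable) hS' f)]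
    with x h1 h2
  rw [h1, h2, Function.comp_apply, h, LinearIsometryEquiv.apply_symm_apply]

end Twisted

/-! ### The strong operator topology and its Borel sets -/

section StrongOperatorTopology

variable {E : Type} [NormedAddCommGroup E] [NormedSpace ℝ E]

lemma continuous_strongOperatorTopology {S : Type*} [TopologicalSpace S] {π : S → E ≃ₗᵢ[ℝ] E}
    (h : ∀ v, Continuous fun s => π s v) :
    @Continuous S (E ≃ₗᵢ[ℝ] E) _ (strongOperatorTopology E) π :=
  continuous_induced_rng.2 (continuous_pi h)

/-- Isometries are equicontinuous, so convergence on a dense sequence forces convergence at every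
vector, uniformly in the operator. -/
lemma strongOperatorTopology_eq_induced {D : ℕ → E} (hD : DenseRange D) :
    strongOperatorTopology E =
      TopologicalSpace.induced (fun (T : E ≃ₗᵢ[ℝ] E) (n : ℕ) => T (D n)) inferInstance := by
  refine le_antisymm ?_ ?_
  · rw [← continuous_iff_le_induced]
    let _ := strongOperatorTopology E
    have h : Continuous fun (T : E ≃ₗᵢ[ℝ] E) (x : E) => T x := continuous_induced_dom
    exact continuous_pi fun n => (continuous_apply (D n)).comp h
  · let _ : TopologicalSpace (E ≃ₗᵢ[ℝ] E) :=
      TopologicalSpace.induced (fun (T : E ≃ₗᵢ[ℝ] E) (n : ℕ) => T (D n)) inferInstance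
    have h : Continuous fun (T : E ≃ₗᵢ[ℝ] E) (n : ℕ) => T (D n) := continuous_induced_dom
    refine continuous_iff_le_induced.1 (continuous_pi fun v => ?_)
    refine continuous_of_uniform_approx_of_continuous fun u hu => ?_
    obtain ⟨ε, hε, hεu⟩ := Metric.mem_uniformity_dist.1 hu
    obtain ⟨n, hn⟩ := hD.exists_dist_lt v hε
    refine ⟨fun T => T (D n), (continuous_apply n).comp h, fun T => hεu ?_⟩
    rwa [T.dist_map]

/-- The topology is induced from a countable product of copies of `E`, where the Borel σ-algebra is
the product one, so orbit maps detect measurability. -/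
lemma measurable_strongOperatorTopology [SecondCountableTopology E] {S : Type*}
    [MeasurableSpace S] {π : S → E ≃ₗᵢ[ℝ] E}
    (h : ∀ v, @Measurable S E _ (borel E) fun s => π s v) :
    @Measurable S (E ≃ₗᵢ[ℝ] E) _ (@borel (E ≃ₗᵢ[ℝ] E) (strongOperatorTopology E)) π := by
  let _ : MeasurableSpace E := borel E
  have _ : BorelSpace E := ⟨rfl⟩
  rw [strongOperatorTopology_eq_induced (TopologicalSpace.denseRange_denseSeq E), borel_comap,
    measurable_comap_iff, ← BorelSpace.measurable_eq (α := ℕ → E)]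
  exact measurable_pi_iff.2 fun n => h _

end StrongOperatorTopology

/-! ### Steinhaus arguments and automatic continuity -/

section Steinhaus

variable {G : Type*} [Group G] [TopologicalSpace G] [IsTopologicalGroup G]
  [LocallyCompactSpace G] [SecondCountableTopology G] [MeasurableSpace G] [BorelSpace G]

/-- One of countably many sets covering `G` has positive Haar measure, and Steinhaus' theorem
applies to it. -/
lemma exists_div_mem_nhds_one_of_iUnion_eq_univ {A : ℕ → Set G} (hA : ∀ n, MeasurableSet (A n))
    (h : ⋃ n, A n = Set.univ) : ∃ n, A n / A n ∈ nhds (1 : G) := by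
  have h1 : (Measure.haar : Measure G) (⋃ n, A n) ≠ 0 := by
    rw [h]
    exact (Measure.measure_univ_pos.2 (NeZero.ne _)).ne'
  obtain ⟨n, hn⟩ : ∃ n, 0 < (Measure.haar : Measure G) (A n) := by
    by_contra! hcon
    exact h1 (measure_iUnion_null fun n => le_antisymm (hcon n) zero_le)
  exact ⟨n, Measure.div_mem_nhds_one_of_haar_pos Measure.haar (A n) (hA n) hn⟩

/-- Measurable orbit maps of isometric actions are continuous. -/
lemma continuous_of_measurable_of_dist_mul_left {M : Type*} [PseudoMetricSpace M]
    [SecondCountableTopology M] [MeasurableSpace M] [BorelSpace M] {c : G → M}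
    (hc : Measurable c) (h : ∀ g x y, dist (c (g * x)) (c (g * y)) = dist (c x) (c y)) :
    Continuous c := by
  have : Nonempty M := ⟨c 1⟩
  have hone : ContinuousAt c 1 := by
    refine Metric.tendsto_nhds.2 fun ε hε => ?_
    -- The set involves `c g⁻¹` because invariance turns the distance from `c (x / y)` to `c 1` into
    -- that from `c y⁻¹` to `c x⁻¹`.
    obtain ⟨n, hn⟩ := exists_div_mem_nhds_one_of_iUnion_eq_univ
      (A := fun n => {g : G | dist (c g⁻¹) (TopologicalSpace.denseSeq M n) < ε / 2})
      (fun n => measurableSet_lt ((hc.comp measurable_inv).dist measurable_const)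
        measurable_const) (by
        refine Set.eq_univ_of_forall fun g => Set.mem_iUnion.2 ?_
        exact (TopologicalSpace.denseRange_denseSeq M).exists_dist_lt _ (half_pos hε))
    filter_upwards [hn] with g hg
    obtain ⟨x, hx, y, hy, rfl⟩ := Set.mem_div.1 hg
    have h1 : dist (c (x / y)) (c 1) = dist (c y⁻¹) (c x⁻¹) := by
      rw [← h x y⁻¹ x⁻¹, div_eq_mul_inv, mul_inv_cancel]
    rw [h1]
    have := dist_triangle_right (c y⁻¹) (c x⁻¹) (TopologicalSpace.denseSeq M n)
    simp only [Set.mem_ofPred_eq] at hx hy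
    linarith
  refine continuous_iff_continuousAt.2 fun g => Metric.tendsto_nhds.2 fun ε hε => ?_
  have h1 : Filter.Tendsto (fun x => g⁻¹ * x) (nhds g) (nhds 1) := by
    have := (continuous_const_mul g⁻¹).tendsto g
    rwa [inv_mul_cancel] at this
  filter_upwards [h1.eventually (Metric.tendsto_nhds.1 hone ε hε)] with x hx
  rwa [← h g⁻¹ x g, inv_mul_cancel]

/-- A measurable function which is subadditive up to a constant is bounded on compact sets. -/
lemma exists_bound_on_isCompact_of_quasi_subadditive {ψ : G → ℝ} (hψ : Measurable ψ) {C : ℝ}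
    (h : ∀ x y, ψ (x * y⁻¹) ≤ ψ x + ψ y + C) {K : Set G} (hK : IsCompact K) :
    ∃ B, ∀ x ∈ K, ψ x ≤ B := by
  obtain ⟨n, hn⟩ := exists_div_mem_nhds_one_of_iUnion_eq_univ (A := fun n : ℕ => {g : G | ψ g ≤ n})
    (fun n => measurableSet_le hψ measurable_const)
    (Set.eq_univ_of_forall fun g => Set.mem_iUnion.2 (exists_nat_ge (ψ g)))
  have hN : ∀ g ∈ {g : G | ψ g ≤ n} / {g : G | ψ g ≤ n}, ψ g ≤ 2 * n + C := by
    intro g hg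
    obtain ⟨x, hx, y, hy, rfl⟩ := Set.mem_div.1 hg
    simp only [Set.mem_ofPred_eq] at hx hy
    rw [div_eq_mul_inv]
    linarith [h x y]
  refine hK.induction_on ⟨0, by simp⟩ (fun s t hst ⟨B, hB⟩ => ⟨B, fun x hx => hB x (hst hx)⟩)
    (fun s t ⟨B, hB⟩ ⟨B', hB'⟩ => ⟨max B B', fun x hx => ?_⟩) fun g _ => ?_
  · rcases hx with hx | hx
    · exact (hB x hx).trans (le_max_left _ _)
    · exact (hB' x hx).trans (le_max_right _ _)
  · have h1 : Filter.Tendsto (fun x => x * g⁻¹) (nhds g) (nhds 1) := by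
      have := (continuous_mul_const g⁻¹).tendsto g
      rwa [mul_inv_cancel] at this
    refine ⟨_, mem_nhdsWithin_of_mem_nhds (h1 hn), 2 * n + C + ψ g⁻¹ + C, fun x hx => ?_⟩
    have h2 := hN _ hx
    have h3 := h (x * g⁻¹) g⁻¹
    rw [inv_inv, inv_mul_cancel_right] at h3
    linarith

end Steinhaus

/-! ### General properties of the three kinds of pairs -/

section Pairs

variable {G : Type u} [Group G] [TopologicalSpace G] {E : Type} [NormedAddCommGroup E]
  [NormedSpace ℝ E] {π : G → E ≃ₗᵢ[ℝ] E} {b : G → E} {T : KazhdanType}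

lemma KazhdanType.IsPair.defect (h : T.IsPair π b) :
    ∃ D : ℝ, ∀ g h : G, ‖b (g * h) - b g - π g (b h)‖ ≤ D := by
  cases T with
  | F => exact ⟨0, fun x y => by rw [IsCocycle.cocycle h]; simp⟩
  | FF => exact (IsQuasiCocycle.toIsWeakQuasiCocycle h).defect
  | FFF => exact IsWeakQuasiCocycle.defect h

/-- The norm of a pair is quasi-subadditive. -/
lemma KazhdanType.IsPair.norm_mul_inv_le (h : T.IsPair π b) :
    ∃ D : ℝ, ∀ x y : G, ‖b (x * y⁻¹)‖ ≤ ‖b x‖ + ‖b y‖ + D := by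
  obtain ⟨D, hD⟩ := h.defect
  refine ⟨D, fun x y => ?_⟩
  have h1 := hD (x * y⁻¹) y
  rw [inv_mul_cancel_right] at h1
  have h2 : b (x * y⁻¹) = b x - π (x * y⁻¹) (b y) - (b x - b (x * y⁻¹) - π (x * y⁻¹) (b y)) := by
    abel
  calc ‖b (x * y⁻¹)‖ ≤ ‖b x - π (x * y⁻¹) (b y)‖ + ‖b x - b (x * y⁻¹) - π (x * y⁻¹) (b y)‖ := by
        conv_lhs => rw [h2]
        exact norm_sub_le _ _
    _ ≤ ‖b x‖ + ‖π (x * y⁻¹) (b y)‖ + D := add_le_add (norm_sub_le _ _) h1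
    _ = ‖b x‖ + ‖b y‖ + D := by rw [LinearIsometryEquiv.norm_map]

lemma KazhdanType.IsPair.measurable_norm [MeasurableSpace G] [BorelSpace G]
    (h : T.IsPair π b) : Measurable fun g => ‖b g‖ := by
  let _ : MeasurableSpace E := borel E
  have _ : BorelSpace E := ⟨rfl⟩
  have key : ∀ h : @Measurable G E (borel G) (borel E) b, Measurable fun g => ‖b g‖ := by
    intro h
    have h' : Measurable b := by rwa [BorelSpace.measurable_eq (α := G)]
    exact h'.norm
  cases T with
  | F => exact (IsCocycle.continuous_cocycle h).norm.measurable
  | FF => exact key (IsQuasiCocycle.toIsWeakQuasiCocycle h).borel_cocycle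
  | FFF => exact key (IsWeakQuasiCocycle.borel_cocycle h)

/-- On a discrete group the continuity and Borel conditions are vacuous; the algebraic conditions
pull back along homomorphisms. -/
lemma KazhdanType.IsPair.comp_hom_discrete (h : T.IsPair π b) {Γ : Type*} [Group Γ] (f : Γ →* G) :
    @KazhdanType.IsPair T Γ _ ⊥ E _ _ (π ∘ f) (b ∘ f) := by
  let _ : TopologicalSpace Γ := ⊥
  have _ : DiscreteTopology Γ := ⟨rfl⟩
  have key : ∀ h : IsWeakQuasiCocycle π b, IsWeakQuasiCocycle (π ∘ f) (b ∘ f) := by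
    intro h
    obtain ⟨D, hD⟩ := h.defect
    refine ⟨?_, ?_, D, fun x y => ?_⟩
    · rw [borel_eq_top_of_discrete]
      exact fun _ _ => trivial
    · rw [borel_eq_top_of_discrete]
      exact fun _ _ => trivial
    · simp only [Function.comp_apply, map_mul]
      exact hD _ _
  cases T with
  | F =>
    have h' : IsCocycle π b := h
    refine ⟨fun x y => ?_, ?_, ?_, fun x y => ?_⟩
    · simp [h'.map_mul]
    · exact continuous_strongOperatorTopology fun v => continuous_of_discreteTopology
    · exact continuous_of_discreteTopology
    · simp [h'.cocycle]
  | FF =>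
    have h' : IsQuasiCocycle π b := h
    exact ⟨key h'.toIsWeakQuasiCocycle, fun x y => by simp [h'.map_mul]⟩
  | FFF => exact key h

end Pairs

/-! ### Induction of pairs along a measurable cocycle -/

section InducedPair

set_option linter.unusedSectionVars false

variable {G : Type u} [Group G] [MeasurableSpace G]
  {X : Type} [MeasurableSpace X] {μ : Measure X} [IsFiniteMeasure μ]
  [MulAction G X] [SMulInvariantMeasure G X μ]
  {Γ : Type*} [Group Γ] [Countable Γ] [MeasurableSpace Γ] [DiscreteMeasurableSpace Γ]
  {E : Type} [NormedAddCommGroup E] [NormedSpace ℝ E] [SecondCountableTopology E]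
  {p : ℝ≥0∞} [Fact (1 ≤ p)] {α : G → X → Γ}

lemma measurable_shifted_cocycle [MeasurableInv G] [MeasurableSMul₂ G X]
    (hα : Measurable (Function.uncurry α)) :
    Measurable fun q : G × X => α q.1 (q.1⁻¹ • q.2) :=
  hα.comp (measurable_fst.prodMk (measurable_fst.inv.smul measurable_snd))

lemma measurable_shifted_cocycle_right [MeasurableConstSMul G X]
    (hα : Measurable (Function.uncurry α)) (g : G) : Measurable fun x => α g (g⁻¹ • x) :=
  (hα.comp measurable_prodMk_left).comp (measurable_const_smul g⁻¹)

/-- The linear part of the pair induced by a measurable cocycle `α : G × X → Γ`. -/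
noncomputable def inducedRep [MeasurableConstSMul G X] (p : ℝ≥0∞) [Fact (1 ≤ p)] (μ : Measure X)
    [SMulInvariantMeasure G X μ] (hα : Measurable (Function.uncurry α)) (π : Γ → E ≃ₗᵢ[ℝ] E)
    (g : G) : Lp E p μ ≃ₗᵢ[ℝ] Lp E p μ :=
  LinearIsometryEquiv.ofSurjective
    (twistedIsometry p π (measurable_shifted_cocycle_right hα g) (measurePreserving_smul g⁻¹ μ))
    (twistedIsometry_surjective π _ _ (measurePreserving_smul g μ) fun x => smul_inv_smul g x)

lemma coeFn_inducedRep [MeasurableConstSMul G X] (hα : Measurable (Function.uncurry α))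
    (π : Γ → E ≃ₗᵢ[ℝ] E) (g : G) (f : Lp E p μ) :
    inducedRep p μ hα π g f =ᵐ[μ] fun x => π (α g (g⁻¹ • x)) (f (g⁻¹ • x)) :=
  coeFn_twistedIsometry π (measurable_shifted_cocycle_right hα g) (measurePreserving_smul g⁻¹ μ) f

-- For fixed `g` the cocycle takes finitely many values, so the function is bounded, hence in `L^p`
-- of the finite measure `μ`.
omit [SMulInvariantMeasure G X μ] in
lemma memLp_induced [MeasurableConstSMul G X] (hα : Measurable (Function.uncurry α))
    (hfin : ∀ g, (Set.range (α g)).Finite) (b : Γ → E) (g : G) :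
    MemLp (fun x => b (α g (g⁻¹ • x))) p μ := by
  have h1 : StronglyMeasurable fun x => b (α g (g⁻¹ • x)) :=
    StronglyMeasurable.apply_countable_family (T := fun γ (_ : E) => b γ)
      (fun _ => continuous_const) (measurable_shifted_cocycle_right hα g)
      (stronglyMeasurable_const (b := (0 : E)))
  obtain ⟨C, hC⟩ := ((hfin g).image fun γ => ‖b γ‖).bddAbove
  exact MemLp.of_bound h1.aestronglyMeasurable C
    (Filter.Eventually.of_forall fun x => hC ⟨_, ⟨_, rfl⟩, rfl⟩)

/-- The translation part of the pair induced by a measurable cocycle `α : G × X → Γ`. -/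
noncomputable def inducedCocycle [MeasurableConstSMul G X] (p : ℝ≥0∞) [Fact (1 ≤ p)]
    (μ : Measure X) [IsFiniteMeasure μ] (hα : Measurable (Function.uncurry α))
    (hfin : ∀ g, (Set.range (α g)).Finite) (b : Γ → E) (g : G) : Lp E p μ :=
  (memLp_induced hα hfin b g).toLp

lemma coeFn_inducedCocycle [MeasurableConstSMul G X] (hα : Measurable (Function.uncurry α))
    (hfin : ∀ g, (Set.range (α g)).Finite) (b : Γ → E) (g : G) :
    inducedCocycle p μ hα hfin b g =ᵐ[μ] fun x => b (α g (g⁻¹ • x)) :=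
  (memLp_induced hα hfin b g).coeFn_toLp

variable [MeasurableSMul₂ G X]

lemma measurable_inducedRep [MeasurableInv G] (hp : p ≠ ∞) [SecondCountableTopology (Lp E p μ)]
    (hα : Measurable (Function.uncurry α)) (π : Γ → E ≃ₗᵢ[ℝ] E) (f : Lp E p μ) :
    @Measurable G (Lp E p μ) _ (borel _) fun g => inducedRep p μ hα π g f := by
  let _ : MeasurableSpace (Lp E p μ) := borel _
  have _ : BorelSpace (Lp E p μ) := ⟨rfl⟩
  refine measurable_Lp_of_uncurry hp (k := fun g x => π (α g (g⁻¹ • x)) (f (g⁻¹ • x))) ?_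
    fun g => coeFn_inducedRep hα π g f
  exact StronglyMeasurable.apply_countable_family (fun γ => (π γ).continuous)
    (measurable_shifted_cocycle hα) ((Lp.stronglyMeasurable f).comp_measurable
      (measurable_fst.inv.smul measurable_snd))

lemma measurable_inducedCocycle [MeasurableInv G] (hp : p ≠ ∞) [SecondCountableTopology (Lp E p μ)]
    (hα : Measurable (Function.uncurry α)) (hfin : ∀ g, (Set.range (α g)).Finite) (b : Γ → E) :
    @Measurable G (Lp E p μ) _ (borel _) (inducedCocycle p μ hα hfin b) := by
  let _ : MeasurableSpace (Lp E p μ) := borel _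
  have _ : BorelSpace (Lp E p μ) := ⟨rfl⟩
  refine measurable_Lp_of_uncurry hp (k := fun g x => b (α g (g⁻¹ • x))) ?_
    fun g => coeFn_inducedCocycle hα hfin b g
  exact StronglyMeasurable.apply_countable_family (T := fun γ (_ : E) => b γ)
      (fun _ => continuous_const) (measurable_shifted_cocycle hα)
      (stronglyMeasurable_const (b := (0 : E)))

lemma inducedRep_mul (hα : Measurable (Function.uncurry α))
    (hαmul : ∀ g h x, α (g * h) x = α g (h • x) * α h x) {π : Γ → E ≃ₗᵢ[ℝ] E}
    (hπ : ∀ γ γ', π (γ * γ') = π γ * π γ') (g h : G) :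
    inducedRep p μ hα π (g * h) = inducedRep p μ hα π g * inducedRep p μ hα π h := by
  ext1 f
  refine Lp.ext ?_
  filter_upwards [coeFn_inducedRep hα π (g * h) f,
    coeFn_inducedRep hα π g (inducedRep p μ hα π h f),
    (measurePreserving_smul g⁻¹ μ).quasiMeasurePreserving.ae (coeFn_inducedRep hα π h f)]
    with x h1 h2 h3
  have h4 : (inducedRep p μ hα π g * inducedRep p μ hα π h) f =
      inducedRep p μ hα π g (inducedRep p μ hα π h f) := rfl
  rw [h1, h4, h2, h3, hαmul, hπ, mul_inv_rev, mul_smul, smul_inv_smul]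
  rfl

/-- By the cocycle identity the induced defect is pointwise a defect of `(π, b)`. Hence a uniform
bound is inherited, and a defect zero stays zero. -/
lemma inducedCocycle_defect (hα : Measurable (Function.uncurry α))
    (hαmul : ∀ g h x, α (g * h) x = α g (h • x) * α h x)
    (hfin : ∀ g, (Set.range (α g)).Finite) {π : Γ → E ≃ₗᵢ[ℝ] E} {b : Γ → E} (g h : G) :
    (inducedCocycle p μ hα hfin b (g * h) - inducedCocycle p μ hα hfin b g -
      inducedRep p μ hα π g (inducedCocycle p μ hα hfin b h) : Lp E p μ) =ᵐ[μ]
    fun x => b (α g (g⁻¹ • x) * α h (h⁻¹ • g⁻¹ • x)) - b (α g (g⁻¹ • x)) -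
      π (α g (g⁻¹ • x)) (b (α h (h⁻¹ • g⁻¹ • x))) := by
  filter_upwards [coeFn_inducedCocycle (μ := μ) (p := p) hα hfin b (g * h),
    coeFn_inducedCocycle (μ := μ) (p := p) hα hfin b g,
    coeFn_inducedRep hα π g (inducedCocycle p μ hα hfin b h),
    (measurePreserving_smul g⁻¹ μ).quasiMeasurePreserving.ae
      (coeFn_inducedCocycle (μ := μ) (p := p) hα hfin b h),
    Lp.coeFn_sub (inducedCocycle p μ hα hfin b (g * h) - inducedCocycle p μ hα hfin b g)
      (inducedRep p μ hα π g (inducedCocycle p μ hα hfin b h)),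
    Lp.coeFn_sub (inducedCocycle p μ hα hfin b (g * h)) (inducedCocycle p μ hα hfin b g)]
    with x h1 h2 h3 h4 h5 h6
  rw [h5, Pi.sub_apply, h6, Pi.sub_apply, h1, h2, h3, h4, hαmul, mul_inv_rev, mul_smul,
    smul_inv_smul]

variable [TopologicalSpace G] [IsTopologicalGroup G] [LocallyCompactSpace G]
  [SecondCountableTopology G] [BorelSpace G]

/-- Pairs on `Γ` induce pairs of the same kind on `G`. -/
theorem KazhdanType.IsPair.induced [TopologicalSpace Γ] (hp : p ≠ ∞)
    [SecondCountableTopology (Lp E p μ)] {T : KazhdanType} (hα : Measurable (Function.uncurry α))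
    (hαmul : ∀ g h x, α (g * h) x = α g (h • x) * α h x)
    (hfin : ∀ g, (Set.range (α g)).Finite) {π : Γ → E ≃ₗᵢ[ℝ] E} {b : Γ → E}
    (hb : T.IsPair π b) :
    T.IsPair (inducedRep (G := G) p μ hα π) (inducedCocycle p μ hα hfin b) := by
  have hrep := measurable_inducedRep (G := G) (μ := μ) hp hα π
  have hcoc := measurable_inducedCocycle (G := G) (μ := μ) hp hα hfin b
  have hweak : IsWeakQuasiCocycle (inducedRep (G := G) p μ hα π)
      (inducedCocycle p μ hα hfin b) := by
    refine ⟨?_, ?_, ?_⟩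
    · rw [← BorelSpace.measurable_eq (α := G)]
      exact measurable_strongOperatorTopology hrep
    · rwa [← BorelSpace.measurable_eq (α := G)]
    · obtain ⟨D, hD⟩ := hb.defect
      have hD0 : 0 ≤ D := (norm_nonneg _).trans (hD 1 1)
      refine ⟨_, fun g h => Lp.norm_le_of_ae_bound hD0 ?_⟩
      filter_upwards [inducedCocycle_defect (μ := μ) (p := p) hα hαmul hfin (π := π) (b := b) g h]
        with x hx
      rw [hx]
      exact hD _ _
  cases T with
  | FFF => exact hweak
  | FF =>
    have hb' : IsQuasiCocycle π b := hb
    exact ⟨hweak, inducedRep_mul hα hαmul hb'.map_mul⟩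
  | F =>
    have hb' : IsCocycle π b := hb
    have hmul := inducedRep_mul (μ := μ) (p := p) hα hαmul hb'.map_mul
    have hcocycle : ∀ g h : G, inducedCocycle p μ hα hfin b (g * h) =
        inducedCocycle p μ hα hfin b g +
          inducedRep p μ hα π g (inducedCocycle p μ hα hfin b h) := by
      intro g h
      rw [← sub_eq_zero, ← sub_sub]
      refine Lp.ext ?_
      filter_upwards [inducedCocycle_defect (μ := μ) (p := p) hα hαmul hfin (π := π) (b := b) g h,
        Lp.coeFn_zero E p μ] with x hx h0
      rw [hx, h0, hb'.cocycle]
      simp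
    let _ : MeasurableSpace (Lp E p μ) := borel _
    have _ : BorelSpace (Lp E p μ) := ⟨rfl⟩
    -- Both `g ↦ π g f` and `b` are orbit maps of isometric actions, linear and affine respectively,
    -- so their measurability already gives continuity.
    refine ⟨hmul, ?_, ?_, hcocycle⟩
    · refine continuous_strongOperatorTopology fun f =>
        continuous_of_measurable_of_dist_mul_left (hrep f) fun g x y => ?_
      rw [hmul, hmul]
      exact (inducedRep p μ hα π g).dist_map _ _
    · refine continuous_of_measurable_of_dist_mul_left hcoc fun g x y => ?_
      rw [hcocycle, hcocycle, dist_add_left]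
      exact (inducedRep p μ hα π g).dist_map _ _

/-- If `G` has a Kazhdan-type property, then pairs on `Γ` are uniformly bounded in probability
along every measurable cocycle. -/
theorem HasKazhdanProperty.exists_measure_le [StandardBorelSpace X] [TopologicalSpace Γ]
    (hp : p ≠ ∞) {T : KazhdanType} (hG : HasKazhdanProperty T p G) (hE : IsLpSpace p E)
    (hα : Measurable (Function.uncurry α)) (hαmul : ∀ g h x, α (g * h) x = α g (h • x) * α h x)
    (hfin : ∀ g, (Set.range (α g)).Finite) {π : Γ → E ≃ₗᵢ[ℝ] E} {b : Γ → E}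
    (hb : T.IsPair π b) {δ : ℝ≥0∞} (hδ : δ ≠ 0) :
    ∃ t : ℝ, ∀ g : G, μ {x | t < ‖b (α g x)‖} ≤ δ := by
  have := secondCountableTopology_Lp hp μ E
  obtain ⟨C, hC⟩ := hG (Lp E p μ) (hE.bochner hp μ) _ _ (hb.induced (G := G) (μ := μ) hp hα hαmul hfin)
  have hp0 : p ≠ 0 := (zero_lt_one.trans_le Fact.out).ne'
  have hpr : 0 < p.toReal := ENNReal.toReal_pos hp0 hp
  -- Markov's inequality will bound the measure by `(C / t) ^ p`, which tends to zero uniformly in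
  -- `g`.
  have hlim : Filter.Tendsto (fun t : ℝ => (ENNReal.ofReal t)⁻¹ ^ p.toReal *
      ENNReal.ofReal C ^ p.toReal) Filter.atTop (nhds 0) := by
    have h1 : Filter.Tendsto (fun t : ℝ => (ENNReal.ofReal t)⁻¹) Filter.atTop (nhds 0) :=
      by
      have h := tendsto_inv_iff.2 ENNReal.tendsto_ofReal_atTop
      rwa [ENNReal.inv_top] at h
    have h2 := h1.ennrpow_const p.toReal
    rw [ENNReal.zero_rpow_of_pos hpr] at h2
    have h3 := ENNReal.Tendsto.mul_const (b := ENNReal.ofReal C ^ p.toReal) h2 (Or.inr (by finiteness))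
    rwa [zero_mul] at h3
  obtain ⟨t, ht, ht0⟩ := ((hlim.eventually (ge_mem_nhds (pos_iff_ne_zero.2 hδ))).and
    (Filter.eventually_gt_atTop 0)).exists
  refine ⟨t, fun g => ?_⟩
  set f := inducedCocycle p μ hα hfin b g with hf
  have hnorm : eLpNorm f p μ ≤ ENNReal.ofReal C := by
    have h1 := hC g trivial
    rw [← hf, Lp.norm_def] at h1
    exact (ENNReal.le_ofReal_iff_toReal_le (Lp.eLpNorm_ne_top f)
      (ENNReal.toReal_nonneg.trans h1)).2 h1
  have hset : μ {x | t < ‖b (α g x)‖} = μ {x | t < ‖b (α g (g⁻¹ • x))‖} := by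
    have hm : MeasurableSet {x | t < ‖b (α g x)‖} :=
      ((measurable_of_countable fun γ => ‖b γ‖).comp (hα.comp measurable_prodMk_left))
        measurableSet_Ioi
    exact ((measurePreserving_smul g⁻¹ μ).measure_preimage hm.nullMeasurableSet).symm
  rw [hset]
  refine le_trans (measure_mono_ae ?_) ((meas_ge_le_mul_pow_eLpNorm_enorm μ hp0 hp
    (Lp.aestronglyMeasurable f) (ε := ENNReal.ofReal t) (by simpa using ht0)
    (by simp)).trans (le_trans ?_ ht))
  · filter_upwards [coeFn_inducedCocycle (μ := μ) (p := p) hα hfin b g] with x hx h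
    change t < ‖b (α g (g⁻¹ • x))‖ at h
    change ENNReal.ofReal t ≤ ‖f x‖ₑ
    rw [hf, hx, ← ofReal_norm]
    exact ENNReal.ofReal_le_ofReal h.le
  · gcongr

end InducedPair

/-- The right uniformity is complete and countably generated. The Polish property is needed to make
Borel fundamental domains standard Borel spaces. -/
lemma polishSpace_of_locallyCompactGroup (L : Type*) [Group L] [TopologicalSpace L]
    [IsTopologicalGroup L] [LocallyCompactSpace L] [SecondCountableTopology L] [T2Space L] :
    PolishSpace L := by
  let _ : UniformSpace L := IsTopologicalGroup.rightUniformSpace L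
  have : IsRightUniformGroup L := ⟨rfl⟩
  have : CompleteSpace L := IsRightUniformGroup.completeSpace_of_weaklyLocallyCompactSpace
  have : (uniformity L).IsCountablyGenerated := by
    rw [uniformity_eq_comap_nhds_one']
    infer_instance
  infer_instance

/-! ### Fundamental domains of discrete cocompact subgroups -/

section DiscreteCocompact

variable {L : Type*} [Group L] [TopologicalSpace L] [IsTopologicalGroup L]
  [LocallyCompactSpace L] [SecondCountableTopology L] [T2Space L]
  {Γ : Type*} [Group Γ] {ι : Γ →* L}

omit [SecondCountableTopology L] in
/-- For a cocompact discrete subgroup, small neighbourhoods of the identity meet all conjugates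
of the subgroup trivially. -/
lemma exists_nhds_one_conj_trivial (hι : Function.Injective ι)
    (hdisc : ∀ C : Set L, IsCompact C → {γ | ι γ ∈ C}.Finite) {K : Set L} (hK : IsCompact K)
    (hKΓ : ∀ l, ∃ γ, l * ι γ ∈ K) :
    ∃ U : Set L, IsOpen U ∧ 1 ∈ U ∧
      ∀ l γ, ∀ u ∈ U, ∀ u' ∈ U, u * l * ι γ = u' * l → γ = 1 := by
  classical
  obtain ⟨C, hC, hC1⟩ := exists_compact_mem_nhds (1 : L)
  -- Up to conjugation in `Γ` the conjugating element lies in `K`, so only these finitely many `γ`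
  -- can have a conjugate in `C`. For each nontrivial one the conjugates by `K` form a compact set
  -- missing the identity.
  have hfin : {γ | ι γ ∈ K⁻¹ * C * K}.Finite := hdisc _ ((hK.inv.mul hC).mul hK)
  have hN : interior C ∩ ⋂ γ ∈ hfin.toFinset.filter (· ≠ 1), ((fun k => k * ι γ * k⁻¹) '' K)ᶜ ∈
      nhds (1 : L) := by
    refine Filter.inter_mem (interior_mem_nhds.2 hC1) ((Filter.biInter_finset_mem _).2 ?_)
    intro γ hγ
    have hcont : Continuous fun k : L => k * ι γ * k⁻¹ := by fun_prop
    refine (hK.image hcont).isClosed.isOpen_compl.mem_nhds ?_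
    rintro ⟨k, -, hk⟩
    have h1 : ι γ = 1 := by
      have hk' : k * ι γ * k⁻¹ = 1 := hk
      rw [mul_inv_eq_one] at hk'
      exact mul_eq_left.1 hk'
    exact (Finset.mem_filter.1 hγ).2 (hι (by rw [h1, map_one]))
  have hdiv : Filter.Tendsto (fun q : L × L => q.1⁻¹ * q.2) (nhds (1, 1)) (nhds 1) := by
    have : Continuous fun q : L × L => q.1⁻¹ * q.2 := by fun_prop
    have h := this.tendsto (1, 1)
    simpa using h
  obtain ⟨u, hu, v, hv, huv⟩ := mem_nhds_prod_iff.1 (hdiv hN)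
  obtain ⟨U, hUsub, hUo, hU1⟩ := mem_nhds_iff.1 (Filter.inter_mem hu hv)
  refine ⟨U, hUo, hU1, fun l γ a ha a' ha' h => ?_⟩
  obtain ⟨γ₀, hγ₀⟩ := hKΓ l
  by_contra hne
  set k := l * ι γ₀ with hk
  set δ := γ₀⁻¹ * γ * γ₀ with hδ
  have h1 : k * ι δ * k⁻¹ = a⁻¹ * a' := by
    have h2 : a' = a * l * ι γ * l⁻¹ := by rw [h, mul_inv_cancel_right]
    rw [h2, hk, hδ]
    simp only [map_mul, map_inv]
    group
  have h3 := huv (Set.mk_mem_prod (hUsub ha).1 (hUsub ha').2)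
  have h4 : δ ∈ hfin.toFinset.filter (· ≠ 1) := by
    refine Finset.mem_filter.2 ⟨hfin.mem_toFinset.2 ?_, fun h5 => hne ?_⟩
    · refine Set.mem_mul.2 ⟨k⁻¹ * (a⁻¹ * a'), Set.mul_mem_mul (Set.inv_mem_inv.2 hγ₀)
        (interior_subset h3.1), k, hγ₀, ?_⟩
      rw [← h1]
      group
    · have : γ = γ₀ * δ * γ₀⁻¹ := by rw [hδ]; group
      rw [this, h5]
      group
  exact (Set.mem_iInter₂.1 (Set.mem_preimage.1 h3).2 δ h4) ⟨k, hγ₀, h1⟩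

omit [T2Space L] in
/-- A discrete cocompact subgroup has a relatively compact Borel fundamental domain, here given
as a fibre of an equivariant Borel map. -/
lemma exists_equivariant_measurable [Countable Γ] [MeasurableSpace L] [BorelSpace L]
    {K : Set L} (hK : IsCompact K) (hKΓ : ∀ l, ∃ γ, l * ι γ ∈ K) {U : Set L} (hUo : IsOpen U)
    (hU1 : 1 ∈ U) (hU : ∀ l γ, ∀ u ∈ U, ∀ u' ∈ U, u * l * ι γ = u' * l → γ = 1) :
    ∃ j : L → Γ, (∀ γ, MeasurableSet (j ⁻¹' {γ})) ∧ (∀ l γ, j (l * ι γ) = j l * γ) ∧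
      ∃ C, IsCompact C ∧ {l | j l = 1} ⊆ C := by
  classical
  obtain ⟨C, hC, hC1⟩ := exists_compact_mem_nhds (1 : L)
  set V := U ∩ interior C with hV
  have hVo : IsOpen V := hUo.inter isOpen_interior
  have hV1 : (1 : L) ∈ V := ⟨hU1, mem_interior_iff_mem_nhds.2 hC1⟩
  set k := TopologicalSpace.denseSeq L with hk
  have hcov : K ⊆ ⋃ n, {l | l * (k n)⁻¹ ∈ V} := by
    intro l _
    have hopen : IsOpen {x : L | l * x⁻¹ ∈ V} := hVo.preimage (by fun_prop)
    obtain ⟨n, hn⟩ := (TopologicalSpace.denseRange_denseSeq L).exists_mem_open hopen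
      ⟨l, by simpa using hV1⟩
    exact Set.mem_iUnion.2 ⟨n, hn⟩
  obtain ⟨t, ht⟩ := hK.elim_finite_subcover _ (fun n => hVo.preimage (by fun_prop)) hcov
  have hP : ∀ l : L, ∃ n, n ∈ t ∧ ∃ γ, l * ι γ * (k n)⁻¹ ∈ V := by
    intro l
    obtain ⟨γ, hγ⟩ := hKΓ l
    obtain ⟨n, hn, h⟩ := Set.mem_iUnion₂.1 (ht hγ)
    exact ⟨n, hn, γ, h⟩
  have huniq : ∀ (l : L) (n : ℕ) (γ γ' : Γ), l * ι γ * (k n)⁻¹ ∈ V → l * ι γ' * (k n)⁻¹ ∈ V →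
      γ = γ' := by
    intro l n γ γ' h h'
    have := hU (k n) (γ⁻¹ * γ') _ h.1 _ h'.1 (by simp only [map_mul, map_inv]; group)
    exact inv_mul_eq_one.1 this
  -- Among the finitely many translates `V k_n` meeting all orbits, select the first that meets the
  -- orbit of `l`. It does so in a single point `l * ι (c l)`, the representative of the orbit.
  let i : L → ℕ := fun l => Nat.find (hP l)
  have hi : ∀ l, i l ∈ t ∧ ∃ γ, l * ι γ * (k (i l))⁻¹ ∈ V := fun l => Nat.find_spec (hP l)
  choose c hc using fun l => (hi l).2
  have hiinv : ∀ l γ, i (l * ι γ) = i l := by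
    intro l γ
    refine Nat.find_congr' ?_
    intro n
    refine and_congr_right fun _ => ⟨fun ⟨γ', h⟩ => ⟨γ * γ', ?_⟩, fun ⟨γ', h⟩ => ⟨γ⁻¹ * γ', ?_⟩⟩
    · rwa [map_mul, ← mul_assoc]
    · rwa [map_mul, ← mul_assoc, map_inv, mul_inv_cancel_right]
  refine ⟨fun l => (c l)⁻¹, fun γ => ?_, fun l γ => ?_, ⋃ n ∈ t, C * {k n}, ?_, fun l hl => ?_⟩
  · have hset : (fun l => (c l)⁻¹) ⁻¹' {γ} = ⋃ n, ({l | n ∈ t ∧ l * ι γ⁻¹ * (k n)⁻¹ ∈ V} ∩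
        ⋂ m ∈ Finset.range n, {l | m ∈ t ∧ ∃ γ', l * ι γ' * (k m)⁻¹ ∈ V}ᶜ) := by
      ext l
      simp only [Set.mem_preimage, Set.mem_singleton_iff, Set.mem_iUnion, Set.mem_inter_iff,
        Set.mem_iInter, Finset.mem_range, Set.mem_compl_iff, Set.mem_ofPred_eq]
      constructor
      · intro h
        refine ⟨i l, ⟨(hi l).1, ?_⟩, fun m hm => Nat.find_min (hP l) hm⟩
        rw [← h, inv_inv]
        exact hc l
      · rintro ⟨n, ⟨hn, h⟩, hmin⟩
        have hin : i l = n := (Nat.find_eq_iff _).2 ⟨⟨hn, _, h⟩, hmin⟩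
        have hcl := hc l
        rw [hin] at hcl
        rw [huniq l n _ _ hcl h, inv_inv]
    have hmeas : ∀ n γ', MeasurableSet {l : L | l * ι γ' * (k n)⁻¹ ∈ V} := fun n γ' =>
      (hVo.preimage (by fun_prop)).measurableSet
    rw [hset]
    refine MeasurableSet.iUnion fun n => MeasurableSet.inter ?_
      (Finset.measurableSet_biInter _ fun m _ => MeasurableSet.compl ?_)
    · exact (MeasurableSet.const _).inter (hmeas _ _)
    · have : {l | m ∈ t ∧ ∃ γ', l * ι γ' * (k m)⁻¹ ∈ V} =
          {l : L | m ∈ t} ∩ ⋃ γ', {l : L | l * ι γ' * (k m)⁻¹ ∈ V} := by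
        ext l
        simp
      rw [this]
      exact (MeasurableSet.const _).inter (MeasurableSet.iUnion fun γ' => hmeas _ _)
  · have h1 := hc (l * ι γ)
    rw [hiinv, mul_assoc l, ← map_mul] at h1
    have h2 := huniq _ _ _ _ h1 (hc l)
    change (c (l * ι γ))⁻¹ = (c l)⁻¹ * γ
    rw [← h2]
    group
  · exact t.isCompact_biUnion fun n _ => hC.mul isCompact_singleton
  · have h1 : c l = 1 := inv_eq_one.1 hl
    have h2 := hc l
    rw [h1, map_one, mul_one] at h2
    refine Set.mem_iUnion₂.2 ⟨i l, (hi l).1, _, interior_subset h2.2, k (i l), rfl, ?_⟩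
    simp

end DiscreteCocompact

/-! ### Unimodularity and invariant measures -/

section Unimodular

variable {L : Type*} [Group L] [MeasurableSpace L] [MeasurableMul L]
  {Γ : Type*} [Group Γ] [Countable Γ] {ι : Γ →* L}

/-- Two fundamental domains meet every invariant set in sets of the same measure. -/
lemma measure_fundamentalDomain_inter_eq (ρ : Measure L) [ρ.IsMulRightInvariant] {j j' : L → Γ}
    (hj : ∀ γ, MeasurableSet (j ⁻¹' {γ})) (hjmul : ∀ l γ, j (l * ι γ) = j l * γ)
    (hj' : ∀ γ, MeasurableSet (j' ⁻¹' {γ})) (hjmul' : ∀ l γ, j' (l * ι γ) = j' l * γ)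
    {S : Set L} (hS : MeasurableSet S) (hSι : ∀ l γ, l * ι γ ∈ S ↔ l ∈ S) :
    ρ ({l | j l = 1} ∩ S) = ρ ({l | j' l = 1} ∩ S) := by
  have key : ∀ {j j' : L → Γ}, (∀ γ, MeasurableSet (j ⁻¹' {γ})) →
      (∀ γ, MeasurableSet (j' ⁻¹' {γ})) →
      ρ ({l | j l = 1} ∩ S) = ∑' γ, ρ (j ⁻¹' {1} ∩ j' ⁻¹' {γ} ∩ S) := by
    intro j j' h h'
    rw [← measure_iUnion]
    · congr 1
      ext l
      simp only [Set.mem_inter_iff, Set.mem_ofPred_eq, Set.mem_iUnion, Set.mem_preimage,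
        Set.mem_singleton_iff]
      exact ⟨fun ⟨h1, h2⟩ => ⟨j' l, ⟨h1, rfl⟩, h2⟩, fun ⟨γ, ⟨h1, _⟩, h2⟩ => ⟨h1, h2⟩⟩
    · intro γ γ' hne
      refine Set.disjoint_left.2 fun l h1 h2 => hne ?_
      exact h1.1.2.symm.trans h2.1.2
    · exact fun γ => ((h 1).inter (h' γ)).inter hS
  -- Right translation by `ι γ⁻¹` carries the piece `j = 1`, `j' = γ` onto the piece `j = γ⁻¹`, `j'
  -- = 1`; hence the reindexing by inversion.
  rw [key hj hj', key hj' hj, ← (Equiv.inv Γ).tsum_eq]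
  refine tsum_congr fun γ => ?_
  rw [← measure_preimage_mul_right ρ (ι γ⁻¹)]
  congr 1
  ext l
  simp only [Set.mem_inter_iff, Set.mem_preimage, Set.mem_singleton_iff, hSι, hjmul, hjmul',
    Equiv.inv_apply, mul_eq_right, mul_inv_eq_one]
  tauto

end Unimodular

section HaarInvariant

variable {L : Type*} [Group L] [TopologicalSpace L] [IsTopologicalGroup L]
  [LocallyCompactSpace L] [SecondCountableTopology L] [MeasurableSpace L]
  [BorelSpace L] {Γ : Type*} [Group Γ] [Countable Γ] {ι : Γ →* L}

/-- A locally compact group with a discrete cocompact subgroup is unimodular. -/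
lemma exists_biinvariant_measure {j : L → Γ}
    (hj : ∀ γ, MeasurableSet (j ⁻¹' {γ})) (hjmul : ∀ l γ, j (l * ι γ) = j l * γ)
    {C : Set L} (hC : IsCompact C) (hjC : {l | j l = 1} ⊆ C) :
    ∃ ρ : Measure L, ρ.IsMulLeftInvariant ∧ ρ.IsMulRightInvariant ∧
      IsFiniteMeasureOnCompacts ρ ∧ ρ.IsOpenPosMeasure := by
  set η : Measure L := Measure.haar with hη
  set ρ : Measure L := η.inv with hρ
  have hcompact : IsFiniteMeasureOnCompacts ρ := by
    refine ⟨fun K hK => ?_⟩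
    rw [hρ, Measure.inv_apply]
    exact hK.inv.measure_lt_top
  have hopen : ρ.IsOpenPosMeasure := by
    refine ⟨fun U hU hne => ?_⟩
    rw [hρ, Measure.inv_apply]
    exact hU.inv.measure_ne_zero η hne.inv
  refine ⟨ρ, ⟨fun g => ?_⟩, inferInstance, hcompact, hopen⟩
  set F := {l | j l = 1} with hF
  have hFm : MeasurableSet F := hj 1
  have hFfin : ρ F ≠ ∞ := ((measure_mono hjC).trans_lt hC.measure_lt_top).ne
  have hF0 : ρ F ≠ 0 := by
    intro h0
    have huniv : ρ Set.univ = 0 := by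
      have : (Set.univ : Set L) = ⋃ γ, j ⁻¹' {γ} := by
        ext l
        simp
      rw [this]
      refine measure_iUnion_null fun γ => ?_
      rw [← measure_preimage_mul_right ρ (ι γ)]
      refine (congrArg ρ ?_).trans h0
      ext l
      simp [hF, hjmul]
    exact (isOpen_univ.measure_ne_zero ρ ⟨1, trivial⟩) huniv
  have hscale : Measure.map (fun x => g * x) ρ = Measure.modularCharacterFun g⁻¹ • ρ := by
    have h1 := Measure.map_right_mul_eq_modularCharacterFun_smul η g⁻¹
    ext s hs
    rw [Measure.map_apply (measurable_const_mul g) hs, hρ, Measure.smul_apply, Measure.inv_apply,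
      Measure.inv_apply, ← Measure.smul_apply, ← h1,
      Measure.map_apply (measurable_mul_const g⁻¹) hs.inv]
    congr 1
    ext x
    simp
  -- A left translate of the fundamental domain is again one, so it has the same measure. As this is
  -- finite and positive, the modular factor is 1.
  have heq : ρ ((fun x => g * x) ⁻¹' F) = ρ F := by
    have := measure_fundamentalDomain_inter_eq ρ (ι := ι) (j := fun l => j (g * l)) (j' := j)
      (fun γ => measurable_const_mul g (hj γ)) (fun l γ => by rw [← mul_assoc, hjmul]) hj hjmul
      MeasurableSet.univ (by simp)
    simp only [Set.inter_univ] at this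
    exact this
  have h2 : Measure.modularCharacterFun g⁻¹ • ρ F = ρ F := by
    rw [← Measure.smul_apply, ← hscale, Measure.map_apply (measurable_const_mul g) hFm, heq]
  have h3 : Measure.modularCharacterFun g⁻¹ = 1 := by
    rw [ENNReal.smul_def, smul_eq_mul] at h2
    exact_mod_cast (ENNReal.mul_eq_right hF0 hFfin).1 h2
  rw [hscale, h3, one_smul]

end HaarInvariant

section ProductMarginal

variable {G H : Type*} [Group G] [TopologicalSpace G] [IsTopologicalGroup G]
  [MeasurableSpace G] [BorelSpace G]
  [Group H] [TopologicalSpace H] [IsTopologicalGroup H] [LocallyCompactSpace H]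
  [SecondCountableTopology H] [MeasurableSpace H] [BorelSpace H]

/-- A biinvariant measure on a product of groups yields one on each factor. -/
lemma exists_biinvariant_measure_fst (ρ : Measure (G × H)) [ρ.IsMulLeftInvariant]
    [ρ.IsMulRightInvariant] [IsFiniteMeasureOnCompacts ρ] [ρ.IsOpenPosMeasure] :
    ∃ m : Measure G, m.IsMulLeftInvariant ∧ m.IsMulRightInvariant ∧
      IsFiniteMeasureOnCompacts m ∧ m.IsOpenPosMeasure := by
  obtain ⟨K, hK, hK1⟩ := exists_compact_mem_nhds (1 : H)
  obtain ⟨B, hBo, hB1, hBK⟩ : ∃ B : Set H, IsOpen B ∧ 1 ∈ B ∧ B ⊆ K :=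
    ⟨interior K, isOpen_interior, mem_interior_iff_mem_nhds.2 hK1, interior_subset⟩
  have happly : ∀ s, MeasurableSet s →
      (ρ.restrict (Set.univ ×ˢ B)).map Prod.fst s = ρ (s ×ˢ B) := by
    intro s hs
    rw [Measure.map_apply measurable_fst hs, Measure.restrict_apply (measurable_fst hs)]
    congr 1
    ext x
    simp
  refine ⟨(ρ.restrict (Set.univ ×ˢ B)).map Prod.fst, ⟨fun g => ?_⟩, ⟨fun g => ?_⟩,
    ⟨fun s hs => ?_⟩, ⟨fun U hU hne => ?_⟩⟩
  · ext s hs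
    rw [Measure.map_apply (measurable_const_mul g) hs, happly _ hs,
      happly _ (measurable_const_mul g hs), ← measure_preimage_mul ρ (g, 1) (s ×ˢ B)]
    congr 1
    ext x
    simp
  · ext s hs
    rw [Measure.map_apply (measurable_mul_const g) hs, happly _ hs,
      happly _ (measurable_mul_const g hs), ← measure_preimage_mul_right ρ (g, 1) (s ×ˢ B)]
    congr 1
    ext x
    simp
  · refine (measure_mono subset_closure).trans_lt ?_
    rw [happly _ isClosed_closure.measurableSet]
    exact (measure_mono (Set.prod_mono_right hBK)).trans_lt (hs.closure.prod hK).measure_lt_top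
  · rw [happly _ hU.measurableSet]
    exact (hU.prod hBo).measure_ne_zero ρ (hne.prod ⟨1, hB1⟩)

end ProductMarginal

/-! ### The orbit space -/

section HomogeneousSpace

/-- A Borel model, in the lowest universe, of the space of `Γ`-orbits in `L`: the orbit map `q`
and a Borel section `σ` with values in the fundamental domain `j = 1`. -/
lemma exists_orbit_space {L : Type*} [Group L] [TopologicalSpace L] [IsTopologicalGroup L]
    [LocallyCompactSpace L] [SecondCountableTopology L] [T2Space L] [MeasurableSpace L]
    [BorelSpace L] {Γ : Type*} [Group Γ] [Countable Γ] {ι : Γ →* L} {j : L → Γ}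
    (hj : ∀ γ, MeasurableSet (j ⁻¹' {γ})) (hjmul : ∀ l γ, j (l * ι γ) = j l * γ) :
    ∃ (X : Type) (_ : MeasurableSpace X) (_ : StandardBorelSpace X) (q : L → X) (σ : X → L),
      Measurable q ∧ Measurable σ ∧ (∀ x, q (σ x) = x) ∧ (∀ l, σ (q l) = l * ι (j l)⁻¹) ∧
        (∀ x, j (σ x) = 1) ∧ ∀ l γ, q (l * ι γ) = q l := by
  have := polishSpace_of_locallyCompactGroup L
  let F : Set L := j ⁻¹' {1}
  have : StandardBorelSpace F := (hj 1).standardBorel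
  -- `L^p`-spaces are taken over measure spaces in `Type`, so the fundamental domain is replaced by
  -- a Borel subset of the real line.
  let e := (measurableEmbedding_embeddingReal F).equivRange
  have : StandardBorelSpace (Set.range (embeddingReal F)) :=
    (measurableEmbedding_embeddingReal F).measurableSet_range.standardBorel
  let s : L → F := fun l => ⟨l * ι (j l)⁻¹, by
    change j (l * ι (j l)⁻¹) = 1
    rw [hjmul, mul_inv_cancel]⟩
  have hs : Measurable s := by
    refine Measurable.subtype_mk ?_
    let _ : MeasurableSpace Γ := ⊤
    have hjm : Measurable j := measurable_to_countable' hj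
    have hι : Measurable fun γ : Γ => ι γ⁻¹ := measurable_from_top
    exact measurable_id.mul (hι.comp hjm)
  have hsF : ∀ x : F, s x = x := by
    intro x
    have hx : j x = 1 := x.2
    ext
    simp [s, hx]
  have hsι : ∀ l γ, s (l * ι γ) = s l := by
    intro l γ
    ext
    simp [s, hjmul]
  refine ⟨Set.range (embeddingReal F), inferInstance, inferInstance, fun l => e (s l),
    fun x => e.symm x, e.measurable.comp hs, measurable_subtype_coe.comp e.symm.measurable,
    fun x => ?_, fun l => ?_, fun x => (e.symm x).2, fun l γ => ?_⟩
  · change e (s (e.symm x : F)) = x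
    rw [hsF, e.apply_symm_apply]
  · change ((e.symm (e (s l)) : F) : L) = _
    rw [e.symm_apply_apply]
  · change e (s (l * ι γ)) = e (s l)
    rw [hsι]

end HomogeneousSpace

/-! ### Boundedness over compact sets of the internal group -/

section Boundedness

variable {G : Type u} {H : Type v} [Group G] [TopologicalSpace G] [IsTopologicalGroup G]
  [LocallyCompactSpace G] [SecondCountableTopology G] [T2Space G]
  [Group H] [TopologicalSpace H] [IsTopologicalGroup H]
  [LocallyCompactSpace H] [SecondCountableTopology H] [T2Space H]
  {Γ : Type*} [Group Γ] [Countable Γ] {ι : Γ →* G × H}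

/-- Let `Γ` be a discrete cocompact subgroup of `G × H`, where `G` has a Kazhdan-type property.
Then pairs on `Γ` are bounded on the elements of `Γ` whose second coordinate lies in a given
compact subset of `H`. -/
theorem HasKazhdanProperty.exists_bound_of_snd_mem_isCompact [TopologicalSpace Γ]
    {p : ℝ≥0∞} [Fact (1 ≤ p)] (hp : p ≠ ∞) {T : KazhdanType} (hG : HasKazhdanProperty T p G)
    (hι : Function.Injective ι)
    (hdisc : ∀ C : Set (G × H), IsCompact C → {γ | ι γ ∈ C}.Finite) {K : Set (G × H)}
    (hK : IsCompact K) (hKΓ : ∀ l, ∃ γ, l * ι γ ∈ K)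
    {E : Type} [NormedAddCommGroup E] [NormedSpace ℝ E] (hE : IsLpSpace p E)
    {π : Γ → E ≃ₗᵢ[ℝ] E} {b : Γ → E} (hb : T.IsPair π b) {W : Set H} (hW : IsCompact W) :
    ∃ R : ℝ, ∀ γ, (ι γ).2 ∈ W → ‖b γ‖ ≤ R := by
  let _ : MeasurableSpace G := borel G
  have _ : BorelSpace G := ⟨rfl⟩
  let _ : MeasurableSpace H := borel H
  have _ : BorelSpace H := ⟨rfl⟩
  let _ : MeasurableSpace Γ := ⊤
  obtain ⟨U, hUo, hU1, hU⟩ := exists_nhds_one_conj_trivial hι hdisc hK hKΓ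
  obtain ⟨j, hj, hjmul, C, hC, hjC⟩ := exists_equivariant_measurable hK hKΓ hUo hU1 hU
  have hjm : Measurable j := measurable_to_countable' hj
  obtain ⟨ρ, _, _, _, _⟩ := exists_biinvariant_measure hj hjmul hC hjC
  obtain ⟨lam, _, _, _, _⟩ := exists_biinvariant_measure_fst ρ
  obtain ⟨X, _, _, q, σ, hq, hσ, hqσ, hσq, hjσ, hqι⟩ := exists_orbit_space hj hjmul
  have hσC : ∀ x, σ x ∈ C := fun x => hjC (hjσ x)
  have hmk : ∀ g h : G, ((g * h, 1) : G × H) = (g, 1) * (h, 1) := fun g h => by simp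
  -- the action of `G` on the orbit space
  let _ : MulAction G X :=
    { smul := fun g x => q ((g, 1) * σ x)
      one_smul := fun x => by
        change q ((1 : G × H) * σ x) = x
        rw [one_mul, hqσ]
      mul_smul := fun g h x => by
        change q ((g * h, 1) * σ x) = q ((g, 1) * σ (q ((h, 1) * σ x)))
        rw [hσq, ← mul_assoc, hqι, hmk, mul_assoc] }
  have hsmul : ∀ (g : G) (x : X), g • x = q ((g, 1) * σ x) := fun _ _ => rfl
  have _ : MeasurableSMul₂ G X := by
    refine ⟨?_⟩
    change Measurable fun z : G × X => q ((z.1, 1) * σ z.2)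
    exact hq.comp ((measurable_fst.prodMk measurable_const).mul (hσ.comp measurable_snd))
  set μ : Measure X := (ρ.restrict {l | j l = 1}).map q with hμdef
  have hμ : ∀ s, MeasurableSet s → μ s = ρ ({l | j l = 1} ∩ q ⁻¹' s) := by
    intro s hs
    rw [hμdef, Measure.map_apply hq hs, Measure.restrict_apply (hq hs), Set.inter_comm]
  have _ : IsFiniteMeasure μ := by
    refine ⟨?_⟩
    rw [hμ _ MeasurableSet.univ]
    exact (measure_mono (Set.inter_subset_left.trans hjC)).trans_lt hC.measure_lt_top
  have _ : SMulInvariantMeasure G X μ := by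
    refine ⟨fun g s hs => ?_⟩
    have hgs : MeasurableSet ((fun x : X => g • x) ⁻¹' s) := measurable_const_smul g hs
    rw [hμ _ hs, hμ _ hgs, ← measure_preimage_mul ρ (g, 1)⁻¹]
    -- Left translation by `(g, 1)` turns the fundamental domain into another one, and `q ⁻¹' s` is
    -- `Γ`-invariant.
    have h1 := measure_fundamentalDomain_inter_eq ρ (ι := ι) (j := fun l => j ((g, 1)⁻¹ * l))
      (j' := j) (fun γ => measurable_const_mul _ (hj γ)) (fun l γ => by rw [← mul_assoc, hjmul])
      hj hjmul (hq hs) (fun l γ => by rw [Set.mem_preimage, Set.mem_preimage, hqι])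
    rw [← h1]
    congr 1
    ext l
    simp only [Set.mem_preimage, Set.mem_inter_iff, Set.mem_ofPred_eq]
    refine and_congr_right fun _ => ?_
    rw [hsmul, hσq, ← mul_assoc, hqι, mul_inv_cancel_left]
  -- the cocycle
  let α : G → X → Γ := fun g x => j ((g, 1) * σ x)
  have hα : Measurable (Function.uncurry α) :=
    hjm.comp ((measurable_fst.prodMk measurable_const).mul (hσ.comp measurable_snd))
  have hαmul : ∀ g h x, α (g * h) x = α g (h • x) * α h x := by
    intro g h x
    change j ((g * h, 1) * σ x) = j ((g, 1) * σ (q ((h, 1) * σ x))) * j ((h, 1) * σ x)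
    rw [hσq, ← mul_assoc, hjmul, inv_mul_cancel_right, hmk, mul_assoc]
  -- Since `l = σ (q l) * ι (j l)` with `σ (q l) ∈ C`, points of `D` have `ι (j l) ∈ C⁻¹ D`, which
  -- discreteness makes finite.
  have hjfin : ∀ D : Set (G × H), IsCompact D → (j '' D).Finite := by
    intro D hD
    refine (hdisc (C⁻¹ * D) (hC.inv.mul hD)).subset ?_
    rintro _ ⟨l, hl, rfl⟩
    refine Set.mem_mul.2 ⟨(σ (q l))⁻¹, Set.inv_mem_inv.2 (hσC _), l, hl, ?_⟩
    rw [hσq]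
    simp
  have hfin : ∀ g, (Set.range (α g)).Finite := by
    intro g
    refine (hjfin ({(g, 1)} * C) (isCompact_singleton.mul hC)).subset ?_
    rintro _ ⟨x, rfl⟩
    exact ⟨_, Set.mul_mem_mul rfl (hσC x), rfl⟩
  -- a product neighbourhood inside `U`
  obtain ⟨V, B, hVo, hV1, hVinv, hBo, hB1, hVBU, V', hV', hVV', B', hB', hBB'⟩ :
      ∃ (V : Set G) (B : Set H), IsOpen V ∧ 1 ∈ V ∧ (∀ v ∈ V, v⁻¹ ∈ V) ∧ IsOpen B ∧ 1 ∈ B ∧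
        (∀ a ∈ V, ∀ c ∈ B, ((a, c) : G × H) ∈ U) ∧ ∃ V' : Set G, IsCompact V' ∧ V ⊆ V' ∧
          ∃ B' : Set H, IsCompact B' ∧ B ⊆ B' := by
    obtain ⟨V', hV', hV'1⟩ := exists_compact_mem_nhds (1 : G)
    obtain ⟨B', hB', hB'1⟩ := exists_compact_mem_nhds (1 : H)
    obtain ⟨V₁, B₁, hV₁, hB₁, hV₁1, hB₁1, hsub⟩ := isOpen_prod_iff.1 hUo 1 1 hU1
    have hVi : IsOpen (V₁ ∩ interior V') := hV₁.inter isOpen_interior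
    refine ⟨(V₁ ∩ interior V') ∩ (V₁ ∩ interior V')⁻¹, B₁ ∩ interior B', hVi.inter hVi.inv, ?_, ?_,
      hB₁.inter isOpen_interior, ⟨hB₁1, mem_interior_iff_mem_nhds.2 hB'1⟩, ?_, V', hV', ?_,
      B', hB', ?_⟩
    · have : (1 : G) ∈ V₁ ∩ interior V' := ⟨hV₁1, mem_interior_iff_mem_nhds.2 hV'1⟩
      exact ⟨this, by simpa using this⟩
    · intro v hv
      exact ⟨hv.2, by simpa using hv.1⟩
    · exact fun a ha c hc => hsub (Set.mk_mem_prod ha.1.1 hc.1)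
    · exact fun v hv => interior_subset hv.1.2
    · exact fun v hv => interior_subset hv.2
  have huniq : ∀ (l : G × H) (γ γ' : Γ) (z : G × H), z * ι γ * l⁻¹ ∈ V ×ˢ B →
      z * ι γ' * l⁻¹ ∈ V ×ˢ B → γ = γ' := by
    intro l γ γ' z h h'
    have := hU l (γ⁻¹ * γ') (z * ι γ * l⁻¹) (hVBU _ h.1 _ h.2) (z * ι γ' * l⁻¹) (hVBU _ h'.1 _ h'.2)
      (by simp only [map_mul, map_inv]; group)
    exact inv_mul_eq_one.1 this
  -- This is the image of `V ×ˢ B` in the orbit space. It has positive measure and is fixed before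
  -- `γ₀` is chosen.
  let X₀ : Set X := {x | ∃ γ, σ x * ι γ ∈ V ×ˢ B}
  have hX₀ : MeasurableSet X₀ := by
    have : X₀ = ⋃ γ, {x | σ x * ι γ ∈ V ×ˢ B} := by
      ext x
      simp [X₀]
    rw [this]
    exact MeasurableSet.iUnion fun γ =>
      (hσ.mul_const _) (hVo.measurableSet.prod hBo.measurableSet)
  have hμX₀ : μ X₀ ≠ 0 := by
    intro h0
    refine (hVo.prod hBo).measure_ne_zero ρ ⟨(1, 1), hV1, hB1⟩ ?_
    have hcov : V ×ˢ B ⊆ ⋃ γ, {l | j l = γ ∧ q l ∈ X₀} := by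
      intro l hl
      refine Set.mem_iUnion.2 ⟨j l, rfl, j l, ?_⟩
      rw [hσq]
      simpa using hl
    refine measure_mono_null hcov (measure_iUnion_null fun γ => ?_)
    rw [← measure_preimage_mul_right ρ (ι γ), ← h0, hμ _ hX₀]
    congr 1
    ext l
    simp [hjmul, hqι]
  -- the quantitative bounds
  set ψ : Γ → ℝ := fun γ => ‖b γ‖ with hψ
  obtain ⟨D, hDmul, hDinv⟩ : ∃ D, (∀ x y, ψ (x * y) ≤ ψ x + ψ y + D) ∧
      ∀ x, ψ x⁻¹ ≤ ψ x + D := by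
    obtain ⟨D, hD⟩ := hb.norm_mul_inv_le
    have h1 : ∀ x, ψ x⁻¹ ≤ ψ 1 + ψ x + D := fun x => by simpa using hD 1 x
    refine ⟨ψ 1 + 2 * max D 0, fun x y => ?_, fun x => ?_⟩
    · have h2 := hD x y⁻¹
      rw [inv_inv] at h2
      have h3 := h1 y
      have h4 := le_max_left D 0
      change ψ (x * y) ≤ ψ x + ψ y⁻¹ + D at h2
      linarith
    · have h3 := h1 x
      have h4 := le_max_left D 0
      have h5 := le_max_right D 0
      linarith
  obtain ⟨C₁, hC₁⟩ : ∃ C₁, ∀ l ∈ V' ×ˢ (B' * W⁻¹), ψ (j l) ≤ C₁ := by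
    obtain ⟨M, hM⟩ := ((hjfin _ (hV'.prod (hB'.mul hW.inv))).image ψ).bddAbove
    exact ⟨M, fun l hl => hM ⟨_, ⟨l, hl, rfl⟩, rfl⟩⟩
  obtain ⟨C₂, hC₂⟩ : ∃ C₂, ∀ l ∈ V' ×ˢ B', ψ (j l) ≤ C₂ := by
    obtain ⟨M, hM⟩ := ((hjfin _ (hV'.prod hB')).image ψ).bddAbove
    exact ⟨M, fun l hl => hM ⟨_, ⟨l, hl, rfl⟩, rfl⟩⟩
  -- With this `δ` the random walk estimate would give `μ X₀ ≤ μ X₀ / 2`.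
  have hδ : μ X₀ / 16 ≠ 0 := by
    simp [ENNReal.div_eq_zero_iff, hμX₀]
  have := hE.secondCountableTopology hp
  obtain ⟨t, ht⟩ := hG.exists_measure_le (μ := μ) hp hE hα hαmul hfin hb hδ
  -- The `3 t` pays for the three paths, `C₁` and `C₂` for the end points near `γ₀`'s two sides, and
  -- `7 D` for the four products and three inverses involved.
  refine ⟨3 * t + C₁ + C₂ + 7 * D, fun γ₀ hγ₀ => ?_⟩
  by_contra! hlarge
  set g := (ι γ₀).1 with hg
  set w := (ι γ₀).2 with hw
  -- the step distribution
  set Q : Set G := V * {g} * V with hQ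
  have hQo : IsOpen Q := hVo.mul_left
  have hQ0 : lam Q ≠ 0 := hQo.measure_ne_zero lam
    ⟨1 * g * 1, Set.mul_mem_mul (Set.mul_mem_mul hV1 rfl) hV1⟩
  have hQfin : lam Q ≠ ∞ := by
    have hc : IsCompact (V' * {g} * V') := (hV'.mul isCompact_singleton).mul hV'
    refine ((measure_mono ?_).trans_lt hc.measure_lt_top).ne
    exact Set.mul_subset_mul (Set.mul_subset_mul_right hVV') hVV'
  set m : Measure G := (lam Q)⁻¹ • lam.restrict Q with hm
  have _ : IsProbabilityMeasure m := by
    refine ⟨?_⟩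
    rw [hm, Measure.smul_apply, Measure.restrict_apply_univ, smul_eq_mul,
      ENNReal.inv_mul_cancel hQ0 hQfin]
  have hmle : ∀ s, m s ≤ (lam Q)⁻¹ * lam s := by
    intro s
    rw [hm, Measure.smul_apply, smul_eq_mul]
    exact mul_le_mul' le_rfl (Measure.restrict_apply_le _ _)
  -- An arrow belongs to `A` if it moves a lift of its source in `V ×ˢ B` to a point whose first
  -- coordinate is in `V g`. The target is then close to the translate of the base point by `γ₀`.
  let A : Set (G × X) := {z | ∃ γ, σ z.2 * ι γ ∈ V ×ˢ B ∧ z.1 * (σ z.2 * ι γ).1 * g⁻¹ ∈ V}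
  have hA : MeasurableSet A := by
    have : A = ⋃ γ, {z | σ z.2 * ι γ ∈ V ×ˢ B ∧ z.1 * (σ z.2 * ι γ).1 * g⁻¹ ∈ V} := by
      ext z
      simp [A]
    rw [this]
    refine MeasurableSet.iUnion fun γ => MeasurableSet.inter ?_ ?_
    · exact ((hσ.comp measurable_snd).mul_const _) (hVo.measurableSet.prod hBo.measurableSet)
    · exact ((measurable_fst.mul ((hσ.comp measurable_snd).mul_const _).fst).mul_const _)
        hVo.measurableSet
  let Bad : Set (G × X) := {z | t < ψ (α z.1 z.2)}
  have hBad : MeasurableSet Bad :=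
    ((measurable_of_countable ψ).comp hα) measurableSet_Ioi
  have hfinal := RandomWalk.measure_le_of_bad_arrows m μ hA hBad hX₀ (ε := (lam Q)⁻¹ * lam V)
    (δ := μ X₀ / 16) ?_ ?_ ?_ ?_ ht ?_
  · have h1 : μ X₀ = 16 * (μ X₀ / 16) := (ENNReal.mul_div_cancel (by norm_num) (by norm_num)).symm
    have h2 : μ X₀ / 16 ≠ ∞ := ENNReal.div_ne_top (measure_ne_top _ _) (by norm_num)
    replace hfinal := h1.symm.le.trans hfinal
    rw [ENNReal.mul_le_mul_iff_left hδ h2] at hfinal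
    norm_num at hfinal
  · exact mul_ne_zero (ENNReal.inv_ne_zero.2 hQfin) (hVo.measure_ne_zero lam ⟨1, hV1⟩)
  · rintro x ⟨γ, hγ⟩
    have hset : {a | (a, x) ∈ A} = {a | a * ((σ x * ι γ).1 * g⁻¹) ∈ V} := by
      ext a
      simp only [A, Set.mem_ofPred_eq]
      constructor
      · rintro ⟨γ', h1, h2⟩
        rw [huniq 1 γ γ' (σ x) (by simpa using hγ) (by simpa using h1), ← mul_assoc]
        exact h2
      · intro h
        exact ⟨γ, hγ, by rwa [mul_assoc]⟩
    have hsub : {a | a * ((σ x * ι γ).1 * g⁻¹) ∈ V} ⊆ Q := by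
      intro a ha
      refine Set.mem_mul.2 ⟨a * ((σ x * ι γ).1 * g⁻¹) * g, Set.mul_mem_mul ha rfl,
        ((σ x * ι γ).1)⁻¹, hVinv _ hγ.1, ?_⟩
      group
    rw [hset, hm, Measure.smul_apply, smul_eq_mul, Measure.restrict_eq_self _ hsub]
    congr 1
    exact measure_preimage_mul_right lam _ V
  · rintro a x ⟨γ, hγ, -⟩
    exact ⟨γ, hγ⟩
  -- Fibres over targets: all arrows with target `y` use the same `γ`, so they lie in a left
  -- translate of `V⁻¹ = V`. Left invariance of `lam` is used here, right invariance was used for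
  -- sources.
  · intro y
    have key : ∀ a, (a, a⁻¹ • y) ∈ A → ∃ γ, σ y * ι γ * (g, 1)⁻¹ ∈ V ×ˢ B ∧
        a⁻¹ * (σ y * ι γ).1 ∈ V := by
      rintro a ⟨γ, h1, h2⟩
      simp only [hsmul, hσq] at h1 h2
      rw [mul_assoc (((a⁻¹, 1) : G × H) * σ y), ← map_mul, mul_assoc ((a⁻¹, 1) : G × H)] at h1 h2
      set γ' := (j ((a⁻¹, 1) * σ y))⁻¹ * γ with hγ'
      refine ⟨γ', ⟨?_, ?_⟩, h1.1⟩
      · simpa [mul_assoc] using h2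
      · simpa using h1.2
    by_cases hne : ∃ a, (a, a⁻¹ • y) ∈ A
    · obtain ⟨a₀, ha₀⟩ := hne
      obtain ⟨γ, hγ, -⟩ := key a₀ ha₀
      refine (hmle _).trans (mul_le_mul' le_rfl ?_)
      rw [← measure_preimage_mul lam ((σ y * ι γ).1)⁻¹ V]
      refine measure_mono fun a ha => ?_
      obtain ⟨γ', hγ', h⟩ := key a ha
      rw [huniq (g, 1) γ γ' (σ y) hγ hγ']
      have := hVinv _ h
      simpa using this
    · have : {a | (a, a⁻¹ • y) ∈ A} = ∅ := by
        ext a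
        simp only [Set.mem_ofPred_eq, Set.mem_empty_iff_false, iff_false]
        exact fun h => hne ⟨a, h⟩
      rw [this]
      simp
  · intro l₁ h l₂ x hmem
    by_contra! hcon
    obtain ⟨h1, h2, h3⟩ := hcon
    replace h1 : ψ (α l₁ x) ≤ t := not_lt.1 h1
    replace h2 : ψ (α l₂ ((h * l₁) • x)) ≤ t := not_lt.1 h2
    replace h3 : ψ (α (l₂ * h * l₁) x) ≤ t := not_lt.1 h3
    obtain ⟨γ, hγ, hγ'⟩ := hmem
    simp only at hγ hγ'
    set y := l₁ • x with hy
    set u := σ y * ι γ with hu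
    have hju : j u = γ := by rw [hu, hjmul, hjσ, one_mul]
    -- Splitting off `ι γ₀ = (g, w)` leaves a factor in the compact set `V' ×ˢ (B' * W⁻¹)`. So `α h
    -- y` is `γ₀` between two factors of bounded norm.
    have hd : ((h, 1) : G × H) * σ y = (h * u.1 * g⁻¹, u.2 * w⁻¹) * ι γ₀ * ι γ⁻¹ := by
      have e1 : ι γ₀ = (g, w) := rfl
      have e2 : σ y = u * ι γ⁻¹ := by rw [hu, map_inv, mul_inv_cancel_right]
      rw [e2, e1, ← mul_assoc]
      congr 1
      ext <;> simp
    have hαy : α h y = j (h * u.1 * g⁻¹, u.2 * w⁻¹) * γ₀ * γ⁻¹ := by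
      change j ((h, 1) * σ y) = _
      rw [hd, hjmul, hjmul]
    have hb1 : ψ (j (h * u.1 * g⁻¹, u.2 * w⁻¹)) ≤ C₁ :=
      hC₁ _ ⟨hVV' hγ', Set.mul_mem_mul (hBB' hγ.2) (Set.inv_mem_inv.2 hγ₀)⟩
    have hb2 : ψ γ ≤ C₂ := by
      rw [← hju]
      exact hC₂ _ ⟨hVV' hγ.1, hBB' hγ.2⟩
    have hγ₀' : γ₀ = (j (h * u.1 * g⁻¹, u.2 * w⁻¹))⁻¹ * α h y * γ := by
      rw [hαy]
      group
    -- The cocycle form of `h = l₂⁻¹ (l₂ h l₁) l₁⁻¹`.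
    have hαh : α h y = (α l₂ ((h * l₁) • x))⁻¹ * α (l₂ * h * l₁) x * (α l₁ x)⁻¹ := by
      rw [mul_assoc l₂, hαmul l₂, hαmul h, ← hy]
      group
    have i1 := hDmul ((j (h * u.1 * g⁻¹, u.2 * w⁻¹))⁻¹ * α h y) γ
    rw [← hγ₀'] at i1
    have i2 := hDmul (j (h * u.1 * g⁻¹, u.2 * w⁻¹))⁻¹ (α h y)
    have i3 := hDinv (j (h * u.1 * g⁻¹, u.2 * w⁻¹))
    have i4 := hDmul ((α l₂ ((h * l₁) • x))⁻¹ * α (l₂ * h * l₁) x) (α l₁ x)⁻¹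
    rw [← hαh] at i4
    have i5 := hDmul (α l₂ ((h * l₁) • x))⁻¹ (α (l₂ * h * l₁) x)
    have i6 := hDinv (α l₂ ((h * l₁) • x))
    have i7 := hDinv (α l₁ x)
    change _ < ψ γ₀ at hlarge
    linarith

end Boundedness

/-- The star map of a cut-and-project scheme, on the group generated by a subset of a model set. -/
lemma exists_star_map {G : Type u} {H : Type v} [Group G] [Group H] {Γ : Subgroup (G × H)}
    (hinj : Set.InjOn Prod.fst (Γ : Set (G × H))) {W : Set H} {Λ : Set G} (hΛ : Λ ⊆ cutAndProject Γ W) :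
    ∃ τ : Subgroup.closure Λ →* H, (∀ x : Subgroup.closure Λ, ((x : G), τ x) ∈ Γ) ∧
      ∀ x : Subgroup.closure Λ, (x : G) ∈ Λ → τ x ∈ W := by
  let f : Γ →* G := (MonoidHom.fst G H).comp Γ.subtype
  have hf : Function.Injective f := fun x y hxy => Subtype.ext (hinj x.2 y.2 hxy)
  have hle : Subgroup.closure Λ ≤ f.range := by
    refine (Subgroup.closure_le _).2 fun x hx => ?_
    obtain ⟨z, ⟨hz, -⟩, rfl⟩ := hΛ hx
    exact ⟨⟨z, hz⟩, rfl⟩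
  let e := (MonoidHom.ofInjective hf).symm.toMonoidHom.comp (Subgroup.inclusion hle)
  have he : ∀ x, (e x : G × H).1 = x := fun x =>
    congrArg Subtype.val ((MonoidHom.ofInjective hf).apply_symm_apply (Subgroup.inclusion hle x))
  have hmem : ∀ x : Subgroup.closure Λ, ((x : G), (e x : G × H).2) ∈ Γ := fun x => by
    rw [← he x]
    exact (e x).2
  refine ⟨((MonoidHom.snd G H).comp Γ.subtype).comp e, hmem, fun x hx => ?_⟩
  obtain ⟨z, ⟨hz, hzW⟩, hzx⟩ := hΛ hx
  rw [hinj hz (hmem x) hzx] at hzW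
  exact hzW

/-! ### Approximate lattices and graphs of star maps -/

section ApproximateLattices

variable {G : Type u} {H : Type v} [Group G] [TopologicalSpace G] [Group H] [TopologicalSpace H]

/-- Left invariance moves the ball of radius `R` about a point of `Λ` to the ball about 1, which is
compact by properness. -/
lemma IsDelone.exists_isCompact {Λ : Set G} (hΛ : IsDelone Λ) :
    ∃ K : Set G, IsCompact K ∧ ∀ x, ∃ y ∈ Λ, y⁻¹ * x ∈ K := by
  obtain ⟨m, hm, r, R, -, -, -, hR⟩ := hΛ
  obtain ⟨rfl, hproper, hinv⟩ := hm
  refine ⟨Metric.closedBall 1 R, isCompact_closedBall 1 R, fun x => ?_⟩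
  obtain ⟨y, hy, hxy⟩ := hR x
  refine ⟨y, hy, ?_⟩
  rw [Metric.mem_closedBall]
  have := hinv y⁻¹ x y
  rw [inv_mul_cancel] at this
  exact this.trans_le hxy

/-- A group inherits Kazhdan-type properties from its Delone subsets. -/
theorem hasKazhdanProperty_of_isDelone [IsTopologicalGroup G] [LocallyCompactSpace G]
    [SecondCountableTopology G] [T2Space G] {T : KazhdanType} {p : ℝ≥0∞} [Fact (1 ≤ p)]
    {Λ : Set G} (hΛ : IsDelone Λ) (h : ApproximateGroupHasKazhdanProperty T p Λ) :
    HasKazhdanProperty T p G := by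
  intro E _ _ hE π b hb
  let _ : MeasurableSpace G := borel G
  have _ : BorelSpace G := ⟨rfl⟩
  obtain ⟨C, hC⟩ := h E hE _ _ (hb.comp_hom_discrete (Subgroup.closure Λ).subtype)
  obtain ⟨K, hK, hKΛ⟩ := hΛ.exists_isCompact
  obtain ⟨D, hD⟩ := hb.norm_mul_inv_le
  obtain ⟨B, hB⟩ := exists_bound_on_isCompact_of_quasi_subadditive hb.measurable_norm hD hK.inv
  -- Here `x = y * k` with `y ∈ Λ` and `k ∈ K`. Subadditivity is stated for quotients, so the bound
  -- on `K⁻¹` is what is needed.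
  refine ⟨C + B + D, fun x _ => ?_⟩
  obtain ⟨y, hy, hk⟩ := hKΛ x
  have h1 := hC ⟨y, Subgroup.subset_closure hy⟩ hy
  have h2 := hB (y⁻¹ * x)⁻¹ (Set.inv_mem_inv.2 hk)
  have h3 := hD y (y⁻¹ * x)⁻¹
  rw [inv_inv, mul_inv_cancel_left] at h3
  change ‖b y‖ ≤ C at h1
  linarith

lemma finite_preimage_isCompact [IsTopologicalGroup G] [IsTopologicalGroup H] [T2Space G]
    [T2Space H] {Γ : Subgroup (G × H)} [DiscreteTopology Γ] {Γ' : Type*} {ι : Γ' → G × H}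
    (hι : Function.Injective ι) (hιΓ : ∀ x, ι x ∈ Γ) {C : Set (G × H)} (hC : IsCompact C) :
    {x | ι x ∈ C}.Finite := by
  have hclosed : IsClosed (Γ : Set (G × H)) := Γ.isClosed_of_discrete
  have hfin : {z : Γ | (z : G × H) ∈ C}.Finite :=
    (hclosed.isClosedEmbedding_subtypeVal.isCompact_preimage hC).finite_of_discrete
  refine Set.Finite.of_finite_image ((hfin.image Subtype.val).subset ?_) hι.injOn
  rintro _ ⟨x, hx, rfl⟩
  exact ⟨⟨ι x, hιΓ x⟩, hx, rfl⟩

/-- If `Λ` is relatively dense in `G` and a homomorphism `τ` from the group generated by `Λ` has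
dense range and maps `Λ` to a compact set, then the graph of `τ` is cocompact. -/
lemma exists_isCompact_mul_graph_mem [IsTopologicalGroup G] [IsTopologicalGroup H]
    [LocallyCompactSpace H] {Λ : Set G} (hΛ : IsDelone Λ) {τ : Subgroup.closure Λ →* H}
    (hτ : DenseRange τ) {W : Set H} (hW : IsCompact W) 
    (hτW : ∀ x : Subgroup.closure Λ, (x : G) ∈ Λ → τ x ∈ W) :
    ∃ K : Set (G × H), IsCompact K ∧ ∀ l, ∃ x, l * ((Subgroup.closure Λ).subtype.prod τ) x ∈ K := by
  obtain ⟨K, hK, hKΛ⟩ := hΛ.exists_isCompact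
  obtain ⟨U, hU, hU1⟩ := exists_compact_mem_nhds (1 : H)
  -- First density of the image of `τ` brings the `H`-coordinate of `l⁻¹` into `U`. Then a point of
  -- `Λ` brings the `G`-coordinate into `K` and moves the `H`-coordinate only by an element of
  -- `W⁻¹`.
  refine ⟨(K ×ˢ (W⁻¹ * U))⁻¹, (hK.prod (hW.inv.mul hU)).inv, fun l => ?_⟩
  have hnhds : {z : H | z⁻¹ * l⁻¹.2 ∈ U} ∈ nhds l⁻¹.2 := by
    refine ContinuousAt.preimage_mem_nhds (by fun_prop) ?_
    simpa using hU1
  obtain ⟨x, hx⟩ := hτ.exists_mem_open isOpen_interior ⟨_, mem_interior_iff_mem_nhds.2 hnhds⟩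
  replace hx := interior_subset hx
  obtain ⟨y, hy, hyK⟩ := hKΛ ((x : G)⁻¹ * l⁻¹.1)
  let y' : Subgroup.closure Λ := ⟨y, Subgroup.subset_closure hy⟩
  refine ⟨x * y', ?_⟩
  rw [Set.mem_inv]
  refine ⟨?_, ?_⟩
  · simpa [y', mul_assoc] using hyK
  · refine Set.mem_mul.2 ⟨(τ y')⁻¹, Set.inv_mem_inv.2 (hτW y' hy), _, hx, ?_⟩
    simp [mul_assoc]

/-- The star map embeds `Λ^∞` as a graph in `G × H'`, with `H'` the closure of its image.
Discreteness comes from `Γ`, cocompactness from `Λ` being Delone, and `Λ` is the part lying over a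
compact window. -/
theorem HasKazhdanProperty.approximateGroup [IsTopologicalGroup G] [LocallyCompactSpace G]
    [SecondCountableTopology G] [T2Space G] [IsTopologicalGroup H] [LocallyCompactSpace H]
    [SecondCountableTopology H] [T2Space H] {T : KazhdanType} {p : ℝ≥0∞} [Fact (1 ≤ p)]
    (hp : p ≠ ∞) (hG : HasKazhdanProperty T p G) {Λ : Set G} (hΛ : IsDelone Λ)
    {Γ : Subgroup (G × H)} [DiscreteTopology Γ] (hinj : Set.InjOn Prod.fst (Γ : Set (G × H)))
    {W : Set H} (hW : IsCompact W) (hΛW : Λ ⊆ cutAndProject Γ W) :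
    ApproximateGroupHasKazhdanProperty T p Λ := by
  obtain ⟨τ, hτΓ, hτW⟩ := exists_star_map hinj hΛW
  have _ : Countable Γ := countable_of_Lindelof_of_discrete
  have _ : Countable (Subgroup.closure Λ) := by
    refine Function.Injective.countable (f := fun x => (⟨_, hτΓ x⟩ : Γ)) fun x y hxy => ?_
    exact Subtype.ext (congrArg (fun z : Γ => (z : G × H).1) hxy)
  -- replace the internal group by the closure of the image of the star map
  let H' : Subgroup H := τ.range.topologicalClosure
  have hH' : IsClosed (H' : Set H) := τ.range.isClosed_topologicalClosure
  have _ : SecondCountableTopology H' := TopologicalSpace.Subtype.secondCountableTopology _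
  have _ : LocallyCompactSpace H' := hH'.isClosedEmbedding_subtypeVal.locallyCompactSpace
  let τ' : Subgroup.closure Λ →* H' :=
    τ.codRestrict H' fun x => τ.range.le_topologicalClosure ⟨x, rfl⟩
  have hτ' : DenseRange τ' := by
    intro z
    rw [closure_subtype, ← Set.range_comp]
    exact z.2
  have hW' : IsCompact ((↑) ⁻¹' W : Set H') := hH'.isClosedEmbedding_subtypeVal.isCompact_preimage hW
  obtain ⟨K, hK, hKΛ⟩ := exists_isCompact_mul_graph_mem hΛ hτ' hW' hτW
  have hι : Function.Injective ((Subgroup.closure Λ).subtype.prod τ') := fun x y hxy =>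
    Subtype.ext (congrArg Prod.fst hxy)
  have hdisc : ∀ C : Set (G × H'), IsCompact C →
      {x | (Subgroup.closure Λ).subtype.prod τ' x ∈ C}.Finite := by
    intro C hC
    have hj : Continuous (Prod.map id Subtype.val : G × H' → G × H) := by fun_prop
    refine (finite_preimage_isCompact (ι := fun x : Subgroup.closure Λ => ((x : G), τ x)) ?_ hτΓ (hC.image hj)).subset
      fun x hx => ⟨_, hx, rfl⟩
    exact fun x y hxy => Subtype.ext (congrArg Prod.fst hxy)
  intro E _ _ hE π b hb
  let _ : TopologicalSpace (Subgroup.closure Λ) := ⊥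
  obtain ⟨R, hR⟩ := hG.exists_bound_of_snd_mem_isCompact hp hι hdisc hK hKΛ hE hb hW'
  exact ⟨R, fun x hx => hR x (hτW x hx)⟩

end ApproximateLattices

theorem theorem1p3 {G : Type u} [Group G] [TopologicalSpace G] [IsTopologicalGroup G]
    [LocallyCompactSpace G] [SecondCountableTopology G] [T2Space G]
    (T : KazhdanType) (p : ℝ≥0∞) [Fact (1 ≤ p)] (hp_one : 1 < p) (hp_top : p < ⊤)
    (Λ : Set G) (hΛ : IsUniformApproximateLattice Λ)
    (h : IsModelSet.{u, v} Λ ∨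
      (IsMeyerSet.{u, v} Λ ∧
        ∃ M : Set G, Λ ⊆ M ∧ IsModelSetOfAlmostConnectedType.{u, v} M)) :
    HasKazhdanProperty T p G ↔ ApproximateGroupHasKazhdanProperty T p Λ := by
  refine ⟨fun hG => ?_, hasKazhdanProperty_of_isDelone hΛ.delone⟩
  -- Either hypothesis places `Λ` inside some model set. Only the discreteness of its lattice,
  -- injectivity on `G` and compactness of the window enter from here on.
  obtain ⟨M, hΛM, H, _, _, _, _, _, _, Γ, W, hΓ, hW, -, rfl⟩ :
      ∃ M : Set G, Λ ⊆ M ∧ IsModelSet.{u, v} M := by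
    obtain h | ⟨-, M, hΛM, H, i₁, i₂, i₃, i₄, i₅, i₆, -, hM⟩ := h
    · exact ⟨Λ, subset_rfl, h⟩
    · exact ⟨M, hΛM, H, i₁, i₂, i₃, i₄, i₅, i₆, hM⟩
  have := hΓ.lattice.1
  exact hG.approximateGroup hp_top.ne hΛ.delone hΓ.injective hW hΛM
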